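/- Let $p$ be a prime number and let $G$ be a finite $p$-group. Let $G_1=G$, $G_{i+1}=[G,G_i]$ $(i\ge 1)$ be the lower central series of $G$ and write $w_i=\log_p|G_i:G_{i+1}|$. An automorphism $\alpha$ of $G$ is called intense if for every subgroup $H$ of $G$ there is $g\in G$ with $\alpha(H)=gHg^{-1}$; the intense automorphisms form a group $\mathrm{Int}(G)$. Each $\alpha\in\mathrm{Int}(G)$ induces an intense automorphism of the $\mathbb{F}_p$-vector space $G/\Phi(G)$, where $\Phi(G)=[G,G]G^p$, which is multiplication by a scalar in $\mathbb{F}_p^*$ (taken to be $1$ if $G$ is trivial). Composing with the Teichmüller character $\omega:\mathbb{F}_p^*\to\mathbb{Z}_p^*$ gives the intense character $\chi_G:\mathrm{Int}(G)\to\mathbb{Z}_p^*$, and the intensity of $G$ is $\mathrm{inte}(G)=|\mathrm{Int}(G):\ker\chi_G|$. Assume that $G$ has nilpotency class at least $4$ and that $\mathrm{inte}(G)>1$. Then $(w_1,w_2,w_3,w_4)=(2,1,2,1)$. Moreover, the map $x\mapsto x^p$ induces a well-defined bijection $G/G_2\to G_3/G_4$. (The prime $p$ is automatically odd, since $\mathrm{inte}(G)=1$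 for every finite $2$-group.) -/

import Mathlib

namespace Intense

/-- An automorphism `α` of `G` is intense if it sends every subgroup `H` to a conjugate `gHg⁻¹`. -/
def IsIntense {G : Type*} [Group G] (α : MulAut G) : Prop :=
  ∀ H : Subgroup G, ∃ g : G, H.map α.toMonoidHom = H.map (MulAut.conj g).toMonoidHom

/-- In terms of elements: `α` is intense iff for each `H` there is `g` such that
`α x ∈ gHg⁻¹ ↔ x ∈ H` for all `x`. -/
theorem isIntense_iff {G : Type*} [Group G] (α : MulAut G) :
    IsIntense α ↔ ∀ H : Subgroup G, ∃ g : G, ∀ x : G, g⁻¹ * α x * g ∈ H ↔ x ∈ H := by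
  refine forall_congr' fun H => exists_congr fun g => ?_
  have h1 : ∀ x, α x ∈ H.map α.toMonoidHom ↔ x ∈ H := fun x =>
    Subgroup.mem_map_iff_mem (f := α.toMonoidHom) α.injective
  have h2 : ∀ y, y ∈ H.map (MulAut.conj g).toMonoidHom ↔ g⁻¹ * y * g ∈ H := by
    intro y
    constructor
    · rintro ⟨z, hz, rfl⟩
      simpa [mul_assoc] using hz
    · intro hy
      exact ⟨g⁻¹ * y * g, hy, by simp [mul_assoc]⟩
  constructor
  · intro h x
    rw [← h2, ← h, h1]
  · intro h
    ext y
    obtain ⟨x, rfl⟩ := α.surjective y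
    rw [h1, h2, h]

/-- `Int(G)`, the group of intense automorphisms of `G`. -/
def intenseAut (G : Type*) [Group G] : Subgroup (MulAut G) where
  carrier := {α | IsIntense α}
  one_mem' := (isIntense_iff _).2 fun _ => ⟨1, fun x => by simp⟩
  mul_mem' := by
    intro α β hα hβ
    rw [Set.mem_ofPred_eq, isIntense_iff] at *
    intro H
    obtain ⟨g, hg⟩ := hα H
    obtain ⟨k, hk⟩ := hβ H
    refine ⟨α k * g, fun x => ?_⟩
    rw [← hk x, ← hg (k⁻¹ * β x * k)]
    simp [mul_assoc]
  inv_mem' := by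
    intro α hα
    rw [Set.mem_ofPred_eq, isIntense_iff] at *
    intro H
    obtain ⟨g, hg⟩ := hα H
    refine ⟨α⁻¹ g⁻¹, fun x => ?_⟩
    rw [← hg]
    simp [mul_assoc]

/-- Intense automorphisms map every normal subgroup onto itself. -/
theorem map_normal {G : Type*} [Group G] (N : Subgroup G) [hN : N.Normal] (α : intenseAut G) :
    N.map (α : MulAut G).toMonoidHom = N := by
  obtain ⟨g, hg⟩ := α.2 N
  rw [hg]
  exact Subgroup.Normal.map_conj_eq N g

/-- The automorphism `xN ↦ α(x)N` of `G/N` induced by an intense automorphism `α`, which is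
intense again. -/
def inducedAut {G : Type*} [Group G] (N : Subgroup G) [N.Normal] (α : intenseAut G) :
    intenseAut (G ⧸ N) :=
  ⟨QuotientGroup.congr N N (α : MulAut G) (map_normal N α), by
    change IsIntense _
    rw [isIntense_iff]
    intro H
    obtain ⟨g, hg⟩ := (isIntense_iff _).1 α.2 (H.comap (QuotientGroup.mk' N))
    refine ⟨(g : G ⧸ N), fun x => ?_⟩
    induction x using QuotientGroup.induction_on with
    | H x => exact hg x⟩

/-- The homomorphism `Int(G) → Int(G/N)`. -/
def inducedHom {G : Type*} [Group G] (N : Subgroup G) [N.Normal] :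
    intenseAut G →* intenseAut (G ⧸ N) where
  toFun := inducedAut N
  map_one' := by
    ext x
    induction x using QuotientGroup.induction_on with
    | H x => rfl
  map_mul' α β := by
    ext x
    induction x using QuotientGroup.induction_on with
    | H x => rfl

/-- On a group of exponent dividing `p` which is abelian (written multiplicatively), an intense
automorphism is a power map. -/
theorem exists_eq_pow {p : ℕ} [Fact p.Prime] {V : Type*} [Group V]
    (hcomm : ∀ a b : V, a * b = b * a) (hexp : ∀ a : V, a ^ p = 1) (α : intenseAut V) :
    ∃ n : ℤ, ∀ v : V, (α : MulAut V) v = v ^ n := by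
  have key : ∀ v : V, ∃ n : ℤ, (α : MulAut V) v = v ^ n := by
    intro v
    obtain ⟨g, hg⟩ := (isIntense_iff _).1 α.2 (Subgroup.zpowers v)
    have h := (hg v).2 (Subgroup.mem_zpowers v)
    rw [hcomm g⁻¹, mul_assoc, inv_mul_cancel, mul_one] at h
    obtain ⟨n, hn⟩ := h
    exact ⟨n, hn.symm⟩
  have hord : ∀ v : V, v ≠ 1 → orderOf v = p := fun v hv => orderOf_eq_prime (hexp v) hv
  by_cases htriv : ∀ v : V, v = 1
  · exact ⟨1, fun v => by rw [htriv v]; simp⟩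
  push Not at htriv
  obtain ⟨v, hv⟩ := htriv
  obtain ⟨n, hn⟩ := key v
  refine ⟨n, fun w => ?_⟩
  by_cases hw : w ∈ Subgroup.zpowers v
  · obtain ⟨k, rfl⟩ := hw
    change (α : MulAut V) (v ^ k) = (v ^ k) ^ n
    rw [map_zpow, hn, ← zpow_mul, ← zpow_mul, mul_comm]
  obtain ⟨l, hl⟩ := key w
  obtain ⟨m, hm⟩ := key (v * w)
  let _ : CommGroup V := { (inferInstance : Group V) with mul_comm := hcomm }
  rw [map_mul, hn, hl, mul_zpow] at hm
  have h1 : w ^ (l - m) = v ^ (m - n) := by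
    rw [zpow_sub, zpow_sub, ← div_eq_mul_inv, ← div_eq_mul_inv, div_eq_div_iff_mul_eq_mul,
      mul_comm, hm]
  have hp : ∀ (a : V) (k : ℤ), (p : ℤ) ∣ k → a ^ k = 1 := by
    rintro a k ⟨c, rfl⟩
    rw [zpow_mul, zpow_natCast, hexp, one_zpow]
  have hd : (p : ℤ) ∣ l - m := by
    by_contra hnd
    obtain ⟨a, b, hab⟩ := (((Nat.prime_iff_prime_int.1 Fact.out).coprime_iff_not_dvd).2 hnd).symm
    refine hw ⟨(m - n) * a, ?_⟩
    change v ^ ((m - n) * a) = w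
    calc v ^ ((m - n) * a) = w ^ (a * (l - m)) := by rw [zpow_mul, ← h1, ← zpow_mul, mul_comm]
      _ = w ^ (a * (l - m) + b * p) := by rw [zpow_add, hp w (b * p) (Dvd.intro_left b rfl), mul_one]
      _ = w := by rw [hab, zpow_one]
  have hd2 : (p : ℤ) ∣ m - n := by
    rw [← hord v hv, orderOf_dvd_iff_zpow_eq_one, ← h1, hp w _ hd]
  rw [hl, ← mul_inv_eq_one, ← zpow_sub]
  exact hp w _ (by simpa using dvd_add hd hd2)

/-- On an elementary abelian `p`-group `V` (written multiplicatively) the intense automorphisms are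
the scalar multiplications: there is a unique homomorphism `μ : Int(V) → 𝔽ₚ*` such that
`α v = μ(α) v` for all `α` and `v`. -/
theorem existsUnique_scalar (p : ℕ) [Fact p.Prime] {V : Type*} [Group V]
    (hcomm : ∀ a b : V, a * b = b * a) (hexp : ∀ a : V, a ^ p = 1) :
    ∃! μ : intenseAut V →* (ZMod p)ˣ,
      ∀ (α : intenseAut V) (v : V), (α : MulAut V) v = v ^ ((μ α : ZMod p).val) := by
  by_cases htriv : ∀ v : V, v = 1
  · refine ⟨1, fun α v => by rw [htriv v]; simp, fun μ _ => ?_⟩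
    ext α
    have : α = 1 := by
      ext v
      rw [htriv v]
      simp
    simp [this]
  push Not at htriv
  obtain ⟨v, hv⟩ := htriv
  have hord : orderOf v = p := orderOf_eq_prime (hexp v) hv
  have hinj : ∀ a b : ℤ, v ^ a = v ^ b → (a : ZMod p) = b := by
    intro a b h
    rw [zpow_eq_zpow_iff_modEq, hord] at h
    exact (ZMod.intCast_eq_intCast_iff a b p).2 h
  choose n hn using exists_eq_pow (p := p) hcomm hexp
  let f : intenseAut V →* ZMod p :=
    { toFun := fun α => (n α : ZMod p)
      map_one' := by
        have := hinj (n 1) 1 (by rw [← hn 1 v]; simp)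
        simpa using this
      map_mul' := by
        intro α β
        have := hinj (n (α * β)) (n α * n β) (by
          rw [← hn (α * β) v, mul_comm, zpow_mul, ← hn β v, ← hn α]
          rfl)
        simpa using this }
  have hval : ∀ (w : V) (a : ℤ), w ^ ((a : ZMod p).val) = w ^ a := by
    intro w a
    rw [← zpow_natCast, ZMod.val_intCast, zpow_eq_zpow_iff_modEq]
    exact (Int.mod_modEq a p).of_dvd (by exact_mod_cast orderOf_dvd_of_pow_eq_one (hexp w))
  refine ⟨f.toHomUnits, fun α w => ?_, fun μ hμ => ?_⟩
  · rw [MonoidHom.coe_toHomUnits]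
    exact (hn α w).trans (hval w (n α)).symm
  · ext α
    rw [MonoidHom.coe_toHomUnits]
    have := hinj ((μ α : ZMod p).val) (n α) (by rw [zpow_natCast, ← hμ α v, hn α v])
    rw [Int.cast_natCast, ZMod.natCast_zmod_val] at this
    exact this

/-- The homomorphism `μ : Int(V) → 𝔽ₚ*` through which the intense automorphisms act on an
elementary abelian `p`-group `V`. -/
noncomputable def scalar (p : ℕ) [Fact p.Prime] {V : Type*} [Group V]
    (hcomm : ∀ a b : V, a * b = b * a) (hexp : ∀ a : V, a ^ p = 1) :
    intenseAut V →* (ZMod p)ˣ :=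
  (existsUnique_scalar p hcomm hexp).choose

/-- The Teichmüller character `ω : 𝔽ₚ* → ℤₚ*`. -/
noncomputable def teichmullerChar (p : ℕ) [Fact p.Prime] : (ZMod p)ˣ →* ℤ_[p]ˣ :=
  Units.map ((WittVector.equiv p : WittVector p (ZMod p) →* ℤ_[p]).comp (WittVector.teichmuller p))

/-- The Frattini subgroup `Φ(G) = [G,G]Gᵖ` of a finite `p`-group. -/
def frattiniP (p : ℕ) (G : Type*) [Group G] : Subgroup G :=
  commutator G ⊔ Subgroup.closure (Set.range fun x : G => x ^ p)

instance frattiniP_normal (p : ℕ) (G : Type*) [Group G] : (frattiniP p G).Normal :=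
  Subgroup.Normal.of_commutator_le (G := G) le_sup_left

theorem frattiniP_quotient_comm (p : ℕ) (G : Type*) [Group G] (a b : G ⧸ frattiniP p G) :
    a * b = b * a :=
  (Subgroup.Normal.quotient_commutative_iff_commutator_le (N := frattiniP p G).2
    (le_sup_left : commutator G ≤ frattiniP p G)).is_comm.comm a b

theorem frattiniP_quotient_pow (p : ℕ) (G : Type*) [Group G] (a : G ⧸ frattiniP p G) :
    a ^ p = 1 := by
  induction a using QuotientGroup.induction_on with
  | H x =>
    rw [← QuotientGroup.mk_pow, QuotientGroup.eq_one_iff]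
    exact le_sup_right (a := commutator G) (Subgroup.subset_closure ⟨x, rfl⟩)

/-- The intense character `χ_G : Int(G) → Int(G/Φ(G)) → 𝔽ₚ* → ℤₚ*` of a finite `p`-group. -/
noncomputable def intenseChar (p : ℕ) [Fact p.Prime] (G : Type*) [Group G] :
    intenseAut G →* ℤ_[p]ˣ :=
  (teichmullerChar p).comp
    ((scalar p (frattiniP_quotient_comm p G) (frattiniP_quotient_pow p G)).comp
      (inducedHom (frattiniP p G)))

/-- The intensity `inte(G) = |Int(G) : ker χ_G|` of a finite `p`-group. -/
noncomputable def intensity (p : ℕ) [Fact p.Prime] (G : Type*) [Group G] : ℕ :=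
  (intenseChar p G).ker.index

/-- The `i`-th term `G_i` of the lower central series, indexed so that `G_1 = G` and
`G_{i+1} = [G, G_i]` for `i ≥ 1` (the value at `i = 0` is never used). -/
def lcs (G : Type*) [Group G] (i : ℕ) : Subgroup G :=
  (⊤ : Subgroup G).lowerCentralSeries (i - 1)

/-- The `i`-th width `log_p |G_i : G_{i+1}|`. -/
noncomputable def width (p : ℕ) (G : Type*) [Group G] (i : ℕ) : ℝ :=
  Real.logb p ((lcs G (i + 1)).relIndex (lcs G i))

end Intense

namespace Intense

open scoped commutatorElement Pointwise

/-! ### Commutator calculus with central values, and the three subgroups lemma. -/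

section Commutators

variable {G : Type*} [Group G]

/-! A nontrivial intense character yields an intense automorphism `α`, of order a power of a prime q
≠ p, acting on G/Φ(G) as a scalar ℓ ≢ 0, 1 mod p. It permutes the conjugacy class of any subgroup H,
whose size is a power of p, so it fixes some conjugate of H (`IsIntense.conjStable`). All the rest
comes from this property, `ConjStable`, by comparing eigenvalues. G/G_2 has exponent p and `α` acts
on G_i/G_{i+1} as ℓ^i. As neighbouring eigenvalues differ, p-th powers drop two layers
(`pow_mem_lcs`), and complements of a central layer are conjugate (`exists_conj_of_complements`).
The latter makes commutator maps surjective, even two at a time (`exists_commutator_pair`).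

For w_1 and w_2, pass to a quotient with G_4 = 1 and |G_3| = p, and let C be the centraliser of G_2.
The pairing of G with G_2/G_3 bounds |G:C| by |G_2:G_3|, which is exactly the index of the
centraliser modulo G_3 of any element outside G_2. This forces C = ⟨c⟩G_2 and G_2/G_3 cyclic, so
(w_1, w_2) = (2, 1). Since c commutes with all that it commutes with modulo G_3, also ℓ^3 ≡ ℓ, that
is ℓ ≡ -1.

For the rest, pass to G_5 = 1. Then G_2 = ⟨z⟩G_3 is abelian and g ↦ [z,g] identifies G/G_2 with
G_3/G_4, so w_3 = 2. Surjectivity onto G_4 × G_4 gives |G_4|² ≤ p², so w_4 = 1. If x ∉ G_2 had x^p ∈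
G_4, some subgroup ⟨x, un⟩ with u ∈ G_3 and n ∈ G_4 would have no stable conjugate
(`pow_notMem_aux`). Hence x^p has centraliser ⟨x⟩G_2, which makes the power map injective; both
sides have p² elements. -/

theorem commutator_zpow_right {t g : G} (h : ⁅t, g⁆ ∈ Subgroup.center G) (n : ℤ) :
    ⁅t, g ^ n⁆ = ⁅t, g⁆ ^ n := by
  have h1 : t * g * t⁻¹ = ⁅t, g⁆ * g := by simp [commutatorElement_def]
  have h2 : t * g ^ n * t⁻¹ = ⁅t, g⁆ ^ n * g ^ n := by
    rw [← conj_zpow, h1, Commute.mul_zpow]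
    exact ((Subgroup.mem_center_iff.1 h) g).symm
  rw [commutatorElement_def, h2, mul_inv_cancel_right]

theorem commutator_zpow_left {t g : G} (h : ⁅t, g⁆ ∈ Subgroup.center G) (n : ℤ) :
    ⁅t ^ n, g⁆ = ⁅t, g⁆ ^ n := by
  have h' : ⁅g, t⁆ ∈ Subgroup.center G := by
    rw [← commutatorElement_inv]
    exact inv_mem h
  rw [← commutatorElement_inv, commutator_zpow_right h', ← inv_zpow, commutatorElement_inv]

theorem commutator_zpow_zpow {t g : G} (h : ⁅t, g⁆ ∈ Subgroup.center G) (m n : ℤ) :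
    ⁅t ^ m, g ^ n⁆ = ⁅t, g⁆ ^ (m * n) := by
  have h' : ⁅t, g ^ n⁆ ∈ Subgroup.center G := by
    rw [commutator_zpow_right h]
    exact zpow_mem h n
  rw [commutator_zpow_left h', commutator_zpow_right h, ← zpow_mul, mul_comm]

theorem commutator_mul_right {t g h : G} (hc : ⁅t, h⁆ ∈ Subgroup.center G) :
    ⁅t, g * h⁆ = ⁅t, g⁆ * ⁅t, h⁆ := by
  rw [commutatorElement_mul_right_eq_mul_conj, mul_assoc, mul_assoc,
    ← (Subgroup.mem_center_iff.1 hc) g⁻¹, mul_inv_cancel_left]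

theorem commutator_mul_left {a b g : G} (hc : ⁅b, g⁆ ∈ Subgroup.center G) :
    ⁅a * b, g⁆ = ⁅a, g⁆ * ⁅b, g⁆ := by
  rw [commutatorElement_mul_left_eq_conj_mul, (Subgroup.mem_center_iff.1 hc) a,
    mul_inv_cancel_right, (Subgroup.mem_center_iff.1 hc)]

/-- The homomorphism `g ↦ [t, g]` for an element `t` all of whose commutators are central. -/
@[simps]
def commHom (t : G) (h : ∀ g, ⁅t, g⁆ ∈ Subgroup.center G) : G →* G where
  toFun g := ⁅t, g⁆
  map_one' := commutatorElement_one_right t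
  map_mul' _ b := commutator_mul_right (h b)

theorem conj_eq_mul_commutator (x g : G) : g * x * g⁻¹ = x * ⁅x⁻¹, g⁆ := by
  simp [commutatorElement_def, mul_assoc]

/-- The three subgroups lemma, applied in G/N. -/
theorem commutator_commutator_le_of_rotate {H₁ H₂ H₃ N : Subgroup G} [N.Normal]
    (h1 : ⁅⁅H₂, H₃⁆, H₁⁆ ≤ N) (h2 : ⁅⁅H₃, H₁⁆, H₂⁆ ≤ N) : ⁅⁅H₁, H₂⁆, H₃⁆ ≤ N := by
  have key : ∀ K : Subgroup G, K ≤ N ↔ K.map (QuotientGroup.mk' N) = ⊥ := by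
    intro K
    rw [Subgroup.map_eq_bot_iff, QuotientGroup.ker_mk']
  rw [key, Subgroup.map_commutator, Subgroup.map_commutator] at *
  exact Subgroup.commutator_commutator_eq_bot_of_rotate h1 h2

end Commutators

/-! ### The lower central series and its behaviour in quotients. -/

section LowerCentralSeries

variable {G : Type*} [Group G]

instance lcs_normal (i : ℕ) : (lcs G i).Normal := by
  unfold lcs; infer_instance

theorem lcs_one : lcs G 1 = ⊤ := rfl

theorem lcs_succ {i : ℕ} (hi : 1 ≤ i) : lcs G (i + 1) = ⁅lcs G i, ⊤⁆ := by
  obtain ⟨j, rfl⟩ := Nat.exists_eq_add_of_le' hi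
  rfl

theorem conj_mem_lcs_iff {i : ℕ} (g : G) {x : G} : g * x * g⁻¹ ∈ lcs G i ↔ x ∈ lcs G i := by
  refine ⟨fun h => ?_, fun h => (lcs_normal i).conj_mem x h g⟩
  simpa [mul_assoc] using (lcs_normal i).conj_mem _ h g⁻¹

theorem commutator_inv_mem_lcs_iff {i : ℕ} (x g : G) : ⁅x⁻¹, g⁆ ∈ lcs G i ↔ ⁅x, g⁆ ∈ lcs G i := by
  have e : ⁅x⁻¹, g⁆ = x⁻¹ * ⁅x, g⁆⁻¹ * x⁻¹⁻¹ := by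
    rw [commutatorElement_inv_left, commutatorElement_inv, inv_inv]
  rw [e, conj_mem_lcs_iff, inv_mem_iff]

theorem lcs_antitone {i j : ℕ} (h : i ≤ j) : lcs G j ≤ lcs G i :=
  Subgroup.lowerCentralSeries_antitone _ (Nat.sub_le_sub_right h 1)

theorem commutator_mem_lcs {i : ℕ} (hi : 1 ≤ i) {t : G} (ht : t ∈ lcs G i) (g : G) :
    ⁅t, g⁆ ∈ lcs G (i + 1) := by
  rw [lcs_succ hi]
  exact Subgroup.commutator_mem_commutator ht (Subgroup.mem_top g)

theorem commutator_mem_lcs_two (x y : G) : ⁅x, y⁆ ∈ lcs G 2 :=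
  Subgroup.commutator_mem_commutator (Subgroup.mem_top x) (Subgroup.mem_top y)

theorem commutator_lcs_lcs_two_le {i : ℕ} (hi : 1 ≤ i) : ⁅lcs G i, lcs G 2⁆ ≤ lcs G (i + 2) := by
  have h : ⁅⁅lcs G i, (⊤ : Subgroup G)⁆, (⊤ : Subgroup G)⁆ ≤ lcs G (i + 2) := by
    exact (by rw [lcs_succ (Nat.le_add_left 1 i), lcs_succ hi] : lcs G (i + 2) = _).ge
  have h2 : ⁅⁅(⊤ : Subgroup G), (⊤ : Subgroup G)⁆, lcs G i⁆ ≤ lcs G (i + 2) := by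
    refine commutator_commutator_le_of_rotate ?_ h
    rwa [Subgroup.commutator_comm ⊤ (lcs G i)]
  rwa [Subgroup.commutator_comm]

theorem lcs_map {K : Type*} [Group K] {f : G →* K} (hf : Function.Surjective f) (i : ℕ) :
    lcs K i = (lcs G i).map f := by
  unfold lcs
  rw [Subgroup.map_lowerCentralSeries, Subgroup.map_top_of_surjective f hf]

theorem lcs_quotient (N : Subgroup G) [N.Normal] (i : ℕ) :
    lcs (G ⧸ N) i = (lcs G i).map (QuotientGroup.mk' N) :=
  lcs_map (QuotientGroup.mk'_surjective N) i

theorem mk_mem_lcs_of_mem (N : Subgroup G) [N.Normal] {i : ℕ} {x : G} (hx : x ∈ lcs G i) :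
    (x : G ⧸ N) ∈ lcs (G ⧸ N) i := by
  rw [lcs_quotient]
  exact ⟨x, hx, rfl⟩

theorem comap_lcs_quotient {N : Subgroup G} [N.Normal] {i : ℕ} (hN : N ≤ lcs G i) :
    (lcs (G ⧸ N) i).comap (QuotientGroup.mk' N) = lcs G i := by
  rw [lcs_quotient, Subgroup.comap_map_eq_self]
  rwa [QuotientGroup.ker_mk']

theorem mk_mem_lcs_iff {N : Subgroup G} [N.Normal] {i : ℕ} (hN : N ≤ lcs G i) {x : G} :
    (x : G ⧸ N) ∈ lcs (G ⧸ N) i ↔ x ∈ lcs G i := by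
  conv_rhs => rw [← comap_lcs_quotient hN]
  rfl

theorem lcs_quotient_eq_bot {N : Subgroup G} [N.Normal] {i : ℕ} (hN : lcs G i ≤ N) :
    lcs (G ⧸ N) i = ⊥ := by
  rw [lcs_quotient, Subgroup.map_eq_bot_iff, QuotientGroup.ker_mk']
  exact hN

theorem relIndex_lcs_quotient {N : Subgroup G} [N.Normal] {i j : ℕ} (hi : N ≤ lcs G i) :
    (lcs (G ⧸ N) i).relIndex (lcs (G ⧸ N) j) = (lcs G i).relIndex (lcs G j) := by
  conv_rhs => rw [← comap_lcs_quotient hi, Subgroup.relIndex_comap, ← lcs_quotient]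

theorem mem_center_of_mem_lcs {i : ℕ} (hi : 1 ≤ i) (h : lcs G (i + 1) = ⊥) {t : G}
    (ht : t ∈ lcs G i) : t ∈ Subgroup.center G := by
  refine Subgroup.mem_center_iff.2 fun g => ?_
  have := commutator_mem_lcs hi ht g
  rw [h, Subgroup.mem_bot, commutatorElement_eq_one_iff_mul_comm] at this
  exact this.symm

/-- `G_{i+1}` is generated modulo `G_{i+2}` by the commutators `[t, g]` with `t ∈ G_i`. -/
theorem lcs_succ_le {i : ℕ} (hi : 1 ≤ i) {K : Subgroup G}
    (h : ∀ t ∈ lcs G i, ∀ g, ⁅t, g⁆ ∈ K) : lcs G (i + 1) ≤ K := by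
  rw [lcs_succ hi, Subgroup.commutator_le]
  exact fun t ht g _ => h t ht g

/-- An equality between consecutive terms would propagate down the whole series, which reaches the
trivial group by nilpotency. -/
theorem lcs_lt_of_ne_bot [Group.IsNilpotent G] {i : ℕ} (hi : 1 ≤ i) (h : lcs G i ≠ ⊥) :
    lcs G (i + 1) < lcs G i := by
  refine lt_of_le_of_ne (lcs_antitone (Nat.le_succ i)) fun heq => h ?_
  have key : ∀ j, lcs G i ≤ lcs G (i + j) := by
    intro j
    induction j with
    | zero => exact le_rfl
    | succ j ih =>
      rw [← add_assoc, lcs_succ (by omega)]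
      conv_lhs => rw [← heq, lcs_succ hi]
      exact Subgroup.commutator_mono ih le_rfl
  rw [eq_bot_iff, ← Subgroup.lowerCentralSeries_nilpotencyClass (G := G)]
  exact (key (Group.nilpotencyClass G + 1)).trans
    (Subgroup.lowerCentralSeries_antitone _ (by omega))

end LowerCentralSeries

/-! ### Powers and central refinements in p-groups. -/

section PGroups

theorem zpow_eq_one_of_dvd {p : ℕ} {G : Type*} [Group G]
    {x : G} {n : ℤ} (hx : x ^ p = 1) (hn : (p : ℤ) ∣ n) : x ^ n = 1 := by
  obtain ⟨c, rfl⟩ := hn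
  rw [zpow_mul, zpow_natCast, hx, one_zpow]

theorem zpow_eq_zpow_of_dvd {p : ℕ} {G : Type*} [Group G]
    {x : G} {m n : ℤ} (hx : x ^ p = 1) (h : (p : ℤ) ∣ m - n) :
    x ^ m = x ^ n := by
  rw [← mul_inv_eq_one, ← zpow_sub]
  exact zpow_eq_one_of_dvd hx h

variable {p : ℕ} [Fact p.Prime] {G : Type*} [Group G]

theorem mem_of_zpow_mem (hG : IsPGroup p G) {H : Subgroup G} {x : G} {i : ℤ}
    (hx : x ^ i ∈ H) (hi : ¬ (p : ℤ) ∣ i) : x ∈ H := by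
  obtain ⟨k, hk⟩ := hG x
  have hc : IsCoprime i ((p : ℤ) ^ k) :=
    (((Nat.prime_iff_prime_int.1 Fact.out).coprime_iff_not_dvd).2 hi).symm.pow_right
  obtain ⟨a, b, hab⟩ := hc
  have : x = (x ^ i) ^ a := by
    rw [← zpow_mul]
    have h2 : x ^ ((p : ℤ) ^ k) = 1 := by exact_mod_cast hk
    calc x = x ^ (a * i + b * (p : ℤ) ^ k) := by rw [hab, zpow_one]
      _ = x ^ (i * a) := by
        rw [zpow_add, mul_comm b, zpow_mul x _ b, h2, one_zpow, mul_one, mul_comm]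
  rw [this]
  exact zpow_mem hx a

/-- A chain `[B, G] ≤ A < B` of subgroups of a finite `p`-group can be refined by a subgroup of
index `p` in `B`. -/
theorem exists_relIndex_eq_prime [Finite G] (hG : IsPGroup p G) {A B : Subgroup G} (hlt : A < B)
    (hc : ⁅B, (⊤ : Subgroup G)⁆ ≤ A) :
    ∃ M : Subgroup G, M.Normal ∧ A ≤ M ∧ M ≤ B ∧ M.relIndex B = p ∧ ∀ b ∈ B, b ^ p ∈ M := by
  obtain ⟨b, hb⟩ := IsPGroup.iff_card.1 (hG.to_subgroup B)
  obtain ⟨a, ha⟩ := IsPGroup.iff_card.1 ((hG.to_subgroup B).to_subgroup (A.subgroupOf B))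
  have hp := (Fact.out : p.Prime)
  have hne : A.subgroupOf B ≠ ⊤ := fun h => hlt.not_ge (Subgroup.subgroupOf_eq_top.1 h)
  have hab : a < b := by
    have h1 : Nat.card (A.subgroupOf B) < Nat.card B := by
      refine lt_of_le_of_ne (Subgroup.card_le_card_group _) fun h => hne ?_
      exact Subgroup.eq_top_of_card_eq _ h
    rw [ha, hb] at h1
    exact (Nat.pow_lt_pow_iff_right hp.one_lt).1 h1
  obtain ⟨K, hK, hAK⟩ := Sylow.exists_subgroup_card_pow_prime_le p (m := b - 1)
    (by rw [hb]; exact pow_dvd_pow p (Nat.sub_le b 1)) (A.subgroupOf B) ha (by omega)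
  have hKB : K.map B.subtype ≤ B := Subgroup.map_subtype_le K
  have hAK' : A ≤ K.map B.subtype := by
    intro x hx
    exact ⟨⟨x, hlt.le hx⟩, hAK (Subgroup.mem_subgroupOf.2 hx), rfl⟩
  -- Every subgroup between A and B is normal, because [B, G] ≤ A.
  have hN : (K.map B.subtype).Normal := by
    refine Subgroup.commutator_top_right_le_iff.1 ?_
    exact (Subgroup.commutator_mono hKB le_rfl).trans (hc.trans hAK')
  have hidx : (K.map B.subtype).relIndex B = p := by
    rw [Subgroup.relIndex, Subgroup.subgroupOf,
      Subgroup.comap_map_eq_self_of_injective B.subtype_injective]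
    have h1 := K.card_mul_index
    rw [hK, hb] at h1
    have h2 : p ^ b = p ^ (b - 1) * p := by rw [← pow_succ]; congr 1; omega
    rw [h2] at h1
    exact Nat.eq_of_mul_eq_mul_left (pow_pos hp.pos _) h1
  refine ⟨K.map B.subtype, hN, hAK', hKB, hidx, fun x hx => ?_⟩
  have h3 := Subgroup.pow_index_mem ((K.map B.subtype).subgroupOf B) ⟨x, hx⟩
  rw [Subgroup.relIndex] at hidx
  rw [hidx] at h3
  exact h3

end PGroups

/-! ### Stable conjugates, eigenvalues and conjugacy of complements. -/

section ConjStable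

variable {G : Type*} [Group G]

/-- Every subgroup of `G` has a conjugate that is mapped into itself by `α`. -/
def ConjStable (α : G →* G) : Prop :=
  ∀ H : Subgroup G, ∃ g : G, ∀ x ∈ H, ∃ y ∈ H, α (g * x * g⁻¹) = g * y * g⁻¹

theorem ConjStable.map_mem {α : G →* G} (hα : ConjStable α) (N : Subgroup G) [hN : N.Normal]
    {x : G} (hx : x ∈ N) : α x ∈ N := by
  obtain ⟨g, hg⟩ := hα N
  obtain ⟨y, hy, h⟩ := hg (g⁻¹ * x * g) (by simpa using hN.conj_mem x hx g⁻¹)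
  have h2 : g * (g⁻¹ * x * g) * g⁻¹ = x := by group
  rw [h2] at h
  rw [h]
  exact hN.conj_mem y hy g

theorem ConjStable.exists_zpow {α : G →* G} (hα : ConjStable α) (x : G) :
    ∃ (g : G) (k : ℤ), α (g * x * g⁻¹) = (g * x * g⁻¹) ^ k := by
  obtain ⟨g, hg⟩ := hα (Subgroup.zpowers x)
  obtain ⟨_, ⟨k, rfl⟩, h⟩ := hg x (Subgroup.mem_zpowers x)
  exact ⟨g, k, by rw [h, conj_zpow]⟩

theorem ConjStable.exists_zpow_of_mem_center {α : G →* G} (hα : ConjStable α) {x : G}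
    (hx : x ∈ Subgroup.center G) : ∃ k : ℤ, α x = x ^ k := by
  obtain ⟨g, k, h⟩ := hα.exists_zpow x
  rw [Subgroup.mem_center_iff.1 hx g, mul_inv_cancel_right] at h
  exact ⟨k, h⟩

theorem ConjStable.quotient {α : G →* G} (hα : ConjStable α) (N : Subgroup G) [N.Normal]
    (h : N ≤ N.comap α) : ConjStable (QuotientGroup.map N N α h) := by
  intro H
  obtain ⟨g, hg⟩ := hα (H.comap (QuotientGroup.mk' N))
  refine ⟨(g : G ⧸ N), fun x hx => ?_⟩
  induction x using QuotientGroup.induction_on with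
  | H x =>
    obtain ⟨y, hy, hxy⟩ := hg x hx
    refine ⟨(y : G ⧸ N), hy, ?_⟩
    simpa using congrArg (QuotientGroup.mk (s := N)) hxy

variable {p : ℕ} [Fact p.Prime]

/-- This is how eigenvalues are compared: an exponent prime to p can be inverted modulo the order of
x, so exponents matter only modulo p. -/
theorem dvd_sub_of_zpow_mem (hG : IsPGroup p G) {H : Subgroup G} {x : G} (hx : x ∉ H) {i j : ℤ}
    (h : (x ^ i)⁻¹ * x ^ j ∈ H) : (p : ℤ) ∣ j - i := by
  by_contra hd
  refine hx (mem_of_zpow_mem hG (i := j - i) ?_ hd)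
  rwa [← zpow_neg, ← zpow_add, neg_add_eq_sub] at h

theorem dvd_sub_of_zpow_eq (hG : IsPGroup p G) {x : G} (hx : x ≠ 1) {i j : ℤ}
    (h : x ^ i = x ^ j) : (p : ℤ) ∣ j - i :=
  dvd_sub_of_zpow_mem hG (H := ⊥) (by simpa using hx) (by rw [h]; simp)

/-- The eigenvalue of `α` on the centre is unique. -/
theorem ConjStable.mem_of_mem_center {α : G →* G} (hG : IsPGroup p G) (hα : ConjStable α)
    {N : Subgroup G} (hNZ : N ≤ Subgroup.center G) (hN : N ≠ ⊥) {m k : ℤ}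
    (hm : ∀ n ∈ N, α n = n ^ m) {s : G} (hs : s ∈ Subgroup.center G)
    (hk : (s ^ k)⁻¹ * α s ∈ N) (hkm : ¬ (p : ℤ) ∣ k - m) : s ∈ N := by
  by_contra hsN
  obtain ⟨j, hj⟩ := hα.exists_zpow_of_mem_center hs
  rw [hj] at hk
  have hjk := dvd_sub_of_zpow_mem hG hsN hk
  have hjm : ¬ (p : ℤ) ∣ j - m := fun h => hkm (by
    have := dvd_sub h hjk
    rwa [show j - m - (j - k) = k - m by ring] at this)
  obtain ⟨t, ht, ht1⟩ := N.bot_or_exists_ne_one.resolve_left hN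
  have htZ := hNZ ht
  -- Here s has eigenvalue j and t has eigenvalue m, but the central element st also has a single
  -- eigenvalue l. Modulo N this gives l ≡ j.
  obtain ⟨l, hl⟩ := hα.exists_zpow_of_mem_center (mul_mem hs htZ)
  have hst : Commute s t := (Subgroup.mem_center_iff.1 htZ s)
  rw [map_mul, hj, hm _ ht, hst.mul_zpow] at hl
  have h1 : (s ^ l)⁻¹ * s ^ j = t ^ l * (t ^ m)⁻¹ := by
    rw [inv_mul_eq_iff_eq_mul, ← mul_assoc, eq_mul_inv_iff_mul_eq, hl]
  have h2 : (s ^ l)⁻¹ * s ^ j ∈ N := by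
    rw [h1]
    exact mul_mem (zpow_mem ht _) (inv_mem (zpow_mem ht _))
  have hlj := dvd_sub_of_zpow_mem hG hsN h2
  -- A power of s lying in N has both eigenvalues j and m, so it is trivial; then t^l = t^m and l ≡
  -- m as well.
  have h3 : ((s ^ l)⁻¹ * s ^ j) = 1 := by
    have h4 := hm _ h2
    rw [map_mul, map_inv, map_zpow, map_zpow, hj] at h4
    have h5 : (s ^ (-l + j)) ^ j = (s ^ (-l + j)) ^ m := by
      simp only [← zpow_neg, ← zpow_add, ← zpow_mul] at h4 ⊢
      rw [← h4]
      congr 1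
      ring
    by_contra hne
    rw [← zpow_neg, ← zpow_add] at hne
    have := dvd_sub_of_zpow_eq hG hne h5.symm
    exact hjm this
  rw [h1, mul_inv_eq_one] at h3
  have := dvd_sub_of_zpow_eq hG ht1 h3.symm
  exact hjm (by
    have := dvd_add this hlj
    rwa [show l - m + (j - l) = j - m by ring] at this)

section Complements

variable {α : G →* G} {N : Subgroup G} {m k : ℤ}

/-- Let `N` be central with `α n = n ^ m` on `N`. If a conjugate by `g` of a complement `H` of `N`
is `α`-stable, then `α` is the `k`-th power map on this conjugate, if it is so modulo `N`. -/
theorem map_conj_eq_zpow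
    (hm : ∀ n ∈ N, α n = n ^ m) {H : Subgroup G} (hHN : ∀ h ∈ H, h ∈ N → h = 1)
    (hc : ∀ h ∈ H, ∀ g, ⁅h, g⁆ ∈ N) (hk : ∀ h ∈ H, (h ^ k)⁻¹ * α h ∈ N) {g : G}
    (hg : ∀ x ∈ H, ∃ y ∈ H, α (g * x * g⁻¹) = g * y * g⁻¹) {h : G} (hh : h ∈ H) :
    α (g * h * g⁻¹) = (g * h * g⁻¹) ^ k := by
  obtain ⟨y, hy, hy'⟩ := hg h hh
  have key : (h ^ k)⁻¹ * y ∈ N := by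
    have h1 : y = α h * α ⁅h⁻¹, g⁆ * ⁅y⁻¹, g⁆⁻¹ := by
      rw [← map_mul, ← conj_eq_mul_commutator, hy', conj_eq_mul_commutator, mul_inv_cancel_right]
    rw [h1, ← mul_assoc, ← mul_assoc]
    have hn := hc _ (inv_mem hh) g
    refine mul_mem (mul_mem (hk h hh) ?_) (inv_mem (hc _ (inv_mem hy) g))
    rw [hm _ hn]
    exact zpow_mem hn m
  have := hHN _ (mul_mem (inv_mem (zpow_mem hh k)) hy) key
  rw [inv_mul_eq_one] at this
  rw [hy', ← this, conj_zpow]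

/-- On stable conjugates of both complements `α` is the k-th power map, while on N it is the m-th.
Corresponding elements of the two differ by an element of N with both eigenvalues, so they coincide.
-/
theorem exists_conj_of_complements (hG : IsPGroup p G) (hα : ConjStable α)
    (hNZ : N ≤ Subgroup.center G)
    (hm : ∀ n ∈ N, α n = n ^ m) (hkm : ¬ (p : ℤ) ∣ k - m) {H H' : Subgroup G}
    (hHN : ∀ h ∈ H, h ∈ N → h = 1) (hc : ∀ h ∈ H, ∀ g, ⁅h, g⁆ ∈ N)
    (hk : ∀ h ∈ H, (h ^ k)⁻¹ * α h ∈ N)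
    (hHN' : ∀ h ∈ H', h ∈ N → h = 1) (hc' : ∀ h ∈ H', ∀ g, ⁅h, g⁆ ∈ N)
    (hk' : ∀ h ∈ H', (h ^ k)⁻¹ * α h ∈ N) (hHH : ∀ h ∈ H, ∃ h' ∈ H', h⁻¹ * h' ∈ N) :
    ∃ g : G, ∀ h ∈ H, g * h * g⁻¹ ∈ H' := by
  obtain ⟨g₁, hg₁⟩ := hα H
  obtain ⟨g₂, hg₂⟩ := hα H'
  refine ⟨g₂⁻¹ * g₁, fun h hh => ?_⟩
  obtain ⟨h', hh', hn⟩ := hHH h hh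
  have e1 := map_conj_eq_zpow hm hHN hc hk hg₁ hh
  have e2 := map_conj_eq_zpow hm hHN' hc' hk' hg₂ hh'
  set a := g₁ * h * g₁⁻¹ with ha
  set b := g₂ * h' * g₂⁻¹ with hb
  have hab : a⁻¹ * b ∈ N := by
    rw [ha, hb, conj_eq_mul_commutator h, conj_eq_mul_commutator h', mul_inv_rev, mul_assoc,
      ← mul_assoc h⁻¹]
    exact mul_mem (inv_mem (hc _ (inv_mem hh) _)) (mul_mem hn (hc' _ (inv_mem hh') _))
  have hcomm : Commute a (a⁻¹ * b) := Subgroup.mem_center_iff.1 (hNZ hab) a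
  have hbe : b = a * (a⁻¹ * b) := (mul_inv_cancel_left a b).symm
  have h3 : (a⁻¹ * b) ^ m = (a⁻¹ * b) ^ k := by
    rw [← hm _ hab, map_mul, map_inv, e1, e2]
    conv_lhs => rw [hbe, hcomm.mul_zpow, inv_mul_cancel_left]
  have h4 : a⁻¹ * b = 1 := by
    by_contra hne
    exact hkm (dvd_sub_of_zpow_eq hG hne h3)
  rw [inv_mul_eq_one] at h4
  have : g₂⁻¹ * g₁ * h * (g₂⁻¹ * g₁)⁻¹ = g₂⁻¹ * a * g₂ := by rw [ha]; group
  rw [this, h4, hb]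
  have : g₂⁻¹ * (g₂ * h' * g₂⁻¹) * g₂ = h' := by group
  rwa [this]

end Complements

/-- The subgroup generated by two commuting elements. -/
def pairSubgroup {a b : G} (h : Commute a b) : Subgroup G where
  carrier := {x | ∃ i j : ℤ, x = a ^ i * b ^ j}
  one_mem' := ⟨0, 0, by simp⟩
  mul_mem' := by
    rintro _ _ ⟨i, j, rfl⟩ ⟨i', j', rfl⟩
    refine ⟨i + i', j + j', ?_⟩
    rw [zpow_add, zpow_add, mul_assoc, mul_assoc, ← mul_assoc (b ^ j),
      ((h.zpow_zpow i' j).eq).symm, mul_assoc]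
  inv_mem' := by
    rintro _ ⟨i, j, rfl⟩
    refine ⟨-i, -j, ?_⟩
    rw [mul_inv_rev, zpow_neg, zpow_neg, ((h.zpow_zpow i j).inv_inv).eq]

theorem zpow_mul_zpow_mem_pairSubgroup {a b : G} (h : Commute a b) (i j : ℤ) :
    a ^ i * b ^ j ∈ pairSubgroup h := ⟨i, j, rfl⟩

theorem left_mem_pairSubgroup {a b : G} (h : Commute a b) : a ∈ pairSubgroup h :=
  ⟨1, 0, by simp⟩

theorem right_mem_pairSubgroup {a b : G} (h : Commute a b) : b ∈ pairSubgroup h :=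
  ⟨0, 1, by simp⟩

end ConjStable

/-- An endomorphism `α` of a `p`-group that stabilises a conjugate of each subgroup and acts on
the elementary abelian group `G / G_2` as the `ℓ`-th power map, where `ℓ` is neither `0` nor `1`
modulo `p`. -/
structure IsScaling (p : ℕ) (ℓ : ℤ) {G : Type*} [Group G] (α : G →* G) : Prop where
  isPGroup : IsPGroup p G
  conjStable : ConjStable α
  map_top : ∀ x, (x ^ ℓ)⁻¹ * α x ∈ lcs G 2
  pow_mem : ∀ x : G, x ^ p ∈ lcs G 2
  not_dvd : ¬ (p : ℤ) ∣ ℓ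
  not_dvd_sub_one : ¬ (p : ℤ) ∣ ℓ - 1

/-! ### Eigenvalues on the layers and surjectivity of commutator maps. -/

namespace IsScaling

variable {p : ℕ} {ℓ : ℤ} {G : Type*} [Group G] {α : G →* G}

theorem le_comap (h : IsScaling p ℓ α)
    (N : Subgroup G) [N.Normal] : N ≤ N.comap α :=
  fun _ hx => h.conjStable.map_mem N hx

theorem quotient (h : IsScaling p ℓ α)
    (N : Subgroup G) [N.Normal] : IsScaling p ℓ (QuotientGroup.map N N α (h.le_comap N)) where
  isPGroup := h.isPGroup.to_quotient N
  conjStable := h.conjStable.quotient N _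
  map_top x := by
    induction x using QuotientGroup.induction_on with
    | H x => exact mk_mem_lcs_of_mem N (h.map_top x)
  pow_mem x := by
    induction x using QuotientGroup.induction_on with
    | H x => exact mk_mem_lcs_of_mem N (h.pow_mem x)
  not_dvd := h.not_dvd
  not_dvd_sub_one := h.not_dvd_sub_one

/-- Commutation induces a bilinear map G_i/G_{i+1} × G/G_2 → G_{i+1}/G_{i+2} whose values generate
the target: eigenvalues multiply, and exponent p is inherited from G/G_2. -/
theorem map_and_pow (h : IsScaling p ℓ α) {i : ℕ} (hi : 1 ≤ i) :
    ∀ t ∈ lcs G i, (t ^ (ℓ ^ i))⁻¹ * α t ∈ lcs G (i + 1) ∧ t ^ p ∈ lcs G (i + 1) := by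
  induction i, hi using Nat.le_induction with
  | base => exact fun t _ => ⟨by simpa using h.map_top t, h.pow_mem t⟩
  | succ i hi ih =>
    let N := lcs G (i + 2)
    -- Inside the centre the required properties define a subgroup, so they need checking only on
    -- commutators.
    let K : Subgroup (G ⧸ N) :=
      { carrier := {t | t ∈ Subgroup.center (G ⧸ N) ∧
          QuotientGroup.map N N α (h.le_comap N) t = t ^ (ℓ ^ (i + 1)) ∧ t ^ p = 1}
        one_mem' := ⟨one_mem _, by simp, by simp⟩
        mul_mem' := by
          rintro a b ⟨ha, ha1, ha2⟩ ⟨hb, hb1, hb2⟩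
          have hab : Commute a b := Subgroup.mem_center_iff.1 hb a
          exact ⟨mul_mem ha hb, by rw [map_mul, ha1, hb1, hab.mul_zpow],
            by rw [hab.mul_pow, ha2, hb2, one_mul]⟩
        inv_mem' := by
          rintro a ⟨ha, ha1, ha2⟩
          exact ⟨inv_mem ha, by rw [map_inv, ha1, inv_zpow], by rw [inv_pow, ha2, inv_one]⟩ }
    have hbot : lcs (G ⧸ N) (i + 2) = ⊥ := lcs_quotient_eq_bot le_rfl
    have hZ : ∀ t ∈ lcs (G ⧸ N) (i + 1), t ∈ Subgroup.center (G ⧸ N) :=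
      fun t ht => mem_center_of_mem_lcs (by omega) hbot ht
    have key : lcs G (i + 1) ≤ K.comap (QuotientGroup.mk' N) := by
      refine lcs_succ_le hi fun t ht g => ?_
      have hqt := mk_mem_lcs_of_mem N ht
      have hc : ⁅(t : G ⧸ N), (g : G ⧸ N)⁆ ∈ Subgroup.center (G ⧸ N) :=
        hZ _ (commutator_mem_lcs hi hqt _)
      have h2 : ∀ r ∈ lcs G 2, ∀ s ∈ lcs G i, ⁅(s : G ⧸ N), (r : G ⧸ N)⁆ = 1 := by
        intro r hr s hs
        have := commutator_lcs_lcs_two_le hi (Subgroup.commutator_mem_commutator hs hr)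
        rw [← QuotientGroup.eq_one_iff] at this
        exact this
      change ⁅(t : G ⧸ N), (g : G ⧸ N)⁆ ∈ K
      refine ⟨hc, ?_, ?_⟩
      · rw [map_commutatorElement]
        change ⁅((α t : G) : G ⧸ N), ((α g : G) : G ⧸ N)⁆ = _
        obtain ⟨s, hs, hs'⟩ : ∃ s ∈ lcs G (i + 1), α t = t ^ (ℓ ^ i) * s :=
          ⟨_, (ih t ht).1, (mul_inv_cancel_left _ _).symm⟩
        obtain ⟨r, hr, hr'⟩ : ∃ r ∈ lcs G 2, α g = g ^ ℓ * r :=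
          ⟨_, h.map_top g, (mul_inv_cancel_left _ _).symm⟩
        have hs1 : ∀ y : G ⧸ N, ⁅(s : G ⧸ N), y⁆ = 1 := fun y =>
          commutatorElement_eq_one_iff_mul_comm.2
            ((Subgroup.mem_center_iff.1 (hZ _ (mk_mem_lcs_of_mem N hs))) y).symm
        have hr1 : ⁅((t ^ (ℓ ^ i) : G) : G ⧸ N), (r : G ⧸ N)⁆ = 1 := h2 r hr _ (zpow_mem ht _)
        rw [hs', hr', QuotientGroup.mk_mul, QuotientGroup.mk_mul,
          commutator_mul_left (by rw [hs1]; exact one_mem _), hs1, mul_one,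
          commutator_mul_right (by rw [hr1]; exact one_mem _), hr1, mul_one,
          QuotientGroup.mk_zpow, QuotientGroup.mk_zpow, commutator_zpow_zpow hc, pow_succ]
      · rw [← zpow_natCast, ← commutator_zpow_right hc, zpow_natCast]
        exact h2 (g ^ p) (h.pow_mem g) t ht
    intro t ht
    obtain ⟨-, h1, h2⟩ := key ht
    constructor
    · rw [← QuotientGroup.eq]
      exact h1.symm
    · rw [← QuotientGroup.eq_one_iff]
      exact h2

theorem map_mem_lcs (h : IsScaling p ℓ α) {i : ℕ} (hi : 1 ≤ i) {t : G} (ht : t ∈ lcs G i) :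
    (t ^ (ℓ ^ i))⁻¹ * α t ∈ lcs G (i + 1) :=
  (h.map_and_pow hi t ht).1

theorem map_eq_zpow (h : IsScaling p ℓ α) {i : ℕ} (hi : 1 ≤ i) (hbot : lcs G (i + 1) = ⊥) {t : G}
    (ht : t ∈ lcs G i) : α t = t ^ (ℓ ^ i) := by
  have := h.map_mem_lcs hi ht
  rw [hbot, Subgroup.mem_bot, inv_mul_eq_one] at this
  exact this.symm

theorem pow_mem_lcs_succ (h : IsScaling p ℓ α) {i : ℕ} (hi : 1 ≤ i) {t : G} (ht : t ∈ lcs G i) :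
    t ^ p ∈ lcs G (i + 1) :=
  (h.map_and_pow hi t ht).2

variable [Fact p.Prime]

theorem not_dvd_pow (h : IsScaling p ℓ α) (i : ℕ) : ¬ (p : ℤ) ∣ ℓ ^ i :=
  fun hd => h.not_dvd ((Nat.prime_iff_prime_int.1 Fact.out).dvd_of_dvd_pow hd)

theorem not_dvd_pow_sub (h : IsScaling p ℓ α) (i : ℕ) : ¬ (p : ℤ) ∣ ℓ ^ (i + 1) - ℓ ^ i := by
  rw [show ℓ ^ (i + 1) - ℓ ^ i = ℓ ^ i * (ℓ - 1) by ring]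
  intro hd
  rcases (Nat.prime_iff_prime_int.1 Fact.out).dvd_or_dvd hd with h1 | h1
  · exact h.not_dvd_pow i h1
  · exact h.not_dvd_sub_one h1

theorem not_dvd_pow_sub' (h : IsScaling p ℓ α) (i : ℕ) : ¬ (p : ℤ) ∣ ℓ ^ i - ℓ ^ (i + 1) := by
  rw [← dvd_neg, neg_sub]
  exact h.not_dvd_pow_sub i

/-- Outside G_{i+1}, a conjugate of t is an eigenvector with eigenvalue ≡ ℓ^i, and so is its p-th
power. But that power lies in G_{i+1}, where the eigenvalue modulo G_{i+2} is ℓ^{i+1}. -/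
theorem pow_mem_lcs (h : IsScaling p ℓ α) {i : ℕ} (hi : 1 ≤ i) {t : G} (ht : t ∈ lcs G i) :
    t ^ p ∈ lcs G (i + 2) := by
  by_cases ht' : t ∈ lcs G (i + 1)
  · exact h.pow_mem_lcs_succ (by omega) ht'
  obtain ⟨g, k, hk⟩ := h.conjStable.exists_zpow t
  have hconj : ∀ j, ∀ y : G, y ∈ lcs G j ↔ g * y * g⁻¹ ∈ lcs G j := fun j y =>
    (conj_mem_lcs_iff g).symm
  have hk2 := h.map_mem_lcs hi ((hconj i t).1 ht)
  rw [hk] at hk2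
  rw [hconj (i + 1)] at ht'
  have hd := dvd_sub_of_zpow_mem h.isPGroup ht' hk2
  rw [hconj (i + 2), ← conj_pow]
  have hp := h.pow_mem_lcs_succ hi ((hconj i t).1 ht)
  by_contra hw
  have hp2 := h.map_mem_lcs (by omega) hp
  rw [map_pow, hk, ← zpow_natCast, ← zpow_natCast, ← zpow_mul, ← zpow_mul, mul_comm k, zpow_mul,
    zpow_mul, zpow_natCast] at hp2
  have hd2 := dvd_sub_of_zpow_mem h.isPGroup hw hp2
  apply h.not_dvd_pow_sub i
  have := dvd_sub hd hd2
  rwa [show k - ℓ ^ i - (k - ℓ ^ (i + 1)) = ℓ ^ (i + 1) - ℓ ^ i by ring] at this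

/-- The centre of `G / G_{i+2}` meets `G_i / G_{i+2}` in `G_{i+1} / G_{i+2}`. -/
theorem mem_lcs_succ_of_mem_center (h : IsScaling p ℓ α) {i : ℕ} (hi : 1 ≤ i)
    (hbot : lcs G (i + 2) = ⊥) (hne : lcs G (i + 1) ≠ ⊥) {s : G} (hs : s ∈ lcs G i)
    (hsZ : s ∈ Subgroup.center G) : s ∈ lcs G (i + 1) :=
  h.conjStable.mem_of_mem_center h.isPGroup
    (fun _ ht => mem_center_of_mem_lcs (by omega) hbot ht) hne
    (fun _ ht => h.map_eq_zpow (by omega) hbot ht) hsZ (h.map_mem_lcs hi hs)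
    (h.not_dvd_pow_sub' i)

/-- The subgroups ⟨a, b⟩ and ⟨am, bn⟩ are complements of the central G_{i+1} in the same subgroup,
hence conjugate. The conjugating element has the required commutators. -/
theorem exists_commutator_pair (h : IsScaling p ℓ α) {i : ℕ} (hi : 1 ≤ i)
    (hbot : lcs G (i + 2) = ⊥) {a b : G} (ha : a ∈ lcs G i) (hb : b ∈ lcs G i)
    (hab : Commute a b)
    (hind : ∀ r s : ℤ, a ^ r * b ^ s ∈ lcs G (i + 1) → (p : ℤ) ∣ r ∧ (p : ℤ) ∣ s)
    {m n : G} (hm : m ∈ lcs G (i + 1)) (hn : n ∈ lcs G (i + 1)) :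
    ∃ g : G, ⁅g, a⁆ = m ∧ ⁅g, b⁆ = n := by
  have hi1 : 1 ≤ i + 1 := by omega
  have hp1 : ∀ t ∈ lcs G i, t ^ p = 1 := fun t ht => by
    have := h.pow_mem_lcs hi ht
    rwa [hbot, Subgroup.mem_bot] at this
  have hle : lcs G (i + 1) ≤ lcs G i := lcs_antitone (Nat.le_succ i)
  have hNZ : lcs G (i + 1) ≤ Subgroup.center G := fun _ ht => mem_center_of_mem_lcs hi1 hbot ht
  have hmZ := Subgroup.mem_center_iff.1 (hNZ hm)
  have hnZ := Subgroup.mem_center_iff.1 (hNZ hn)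
  have haa : a * m ∈ lcs G i := mul_mem ha (hle hm)
  have hbb : b * n ∈ lcs G i := mul_mem hb (hle hn)
  have hab' : Commute (a * m) (b * n) :=
    (hab.mul_right (hnZ a)).mul_left (Commute.mul_right (hmZ b).symm (hnZ m))
  have hexp : ∀ r s : ℤ, (a * m) ^ r * (b * n) ^ s = (a ^ r * b ^ s) * (m ^ r * n ^ s) := by
    intro r s
    have : Commute (m ^ r) (b ^ s) := Commute.zpow_zpow (hmZ b).symm r s
    rw [Commute.mul_zpow (hmZ a), Commute.mul_zpow (hnZ b), mul_assoc, ← mul_assoc (m ^ r),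
      this.eq]
    simp only [mul_assoc]
  have hind' : ∀ r s : ℤ, (a * m) ^ r * (b * n) ^ s ∈ lcs G (i + 1) →
      (p : ℤ) ∣ r ∧ (p : ℤ) ∣ s := by
    intro r s hrs
    rw [hexp] at hrs
    exact hind r s ((Subgroup.mul_mem_cancel_right _
      (mul_mem (zpow_mem hm r) (zpow_mem hn s))).1 hrs)
  have gen : ∀ {c d : G} (hcd : Commute c d) (_ : c ∈ lcs G i) (_ : d ∈ lcs G i)
      (_ : ∀ r s : ℤ, c ^ r * d ^ s ∈ lcs G (i + 1) → (p : ℤ) ∣ r ∧ (p : ℤ) ∣ s),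
      pairSubgroup hcd ≤ lcs G i ∧ ∀ x ∈ pairSubgroup hcd, x ∈ lcs G (i + 1) → x = 1 := by
    intro c d hcd hc hd hi'
    constructor
    · rintro _ ⟨r, s, rfl⟩
      exact mul_mem (zpow_mem hc r) (zpow_mem hd s)
    · rintro _ ⟨r, s, rfl⟩ hx
      obtain ⟨hr, hs⟩ := hi' r s hx
      rw [zpow_eq_one_of_dvd (hp1 c hc) hr, zpow_eq_one_of_dvd (hp1 d hd) hs, one_mul]
  obtain ⟨hH, hHN⟩ := gen hab ha hb hind
  obtain ⟨hH', hHN'⟩ := gen hab' haa hbb hind'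
  obtain ⟨g, hg⟩ := exists_conj_of_complements (N := lcs G (i + 1)) (m := ℓ ^ (i + 1))
    (k := ℓ ^ i) (H := pairSubgroup hab) (H' := pairSubgroup hab') h.isPGroup h.conjStable
    hNZ (fun _ ht => h.map_eq_zpow hi1 hbot ht) (h.not_dvd_pow_sub' i) hHN
    (fun x hx y => commutator_mem_lcs hi (hH hx) y) (fun x hx => h.map_mem_lcs hi (hH hx)) hHN'
    (fun x hx y => commutator_mem_lcs hi (hH' hx) y) (fun x hx => h.map_mem_lcs hi (hH' hx)) (by
      rintro _ ⟨r, s, rfl⟩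
      refine ⟨_, zpow_mul_zpow_mem_pairSubgroup hab' r s, ?_⟩
      rw [hexp, inv_mul_cancel_left]
      exact mul_mem (zpow_mem hm r) (zpow_mem hn s))
  -- Both gcg⁻¹ and ce lie in ⟨am, bn⟩ and agree modulo G_{i+1}, which meets that subgroup
  -- trivially; so they are equal.
  have fin : ∀ {c e : G} (r s r₀ s₀ : ℤ), c ∈ lcs G i → e ∈ lcs G (i + 1) →
      c = a ^ r₀ * b ^ s₀ → c * e = (a * m) ^ r₀ * (b * n) ^ s₀ →
      g * c * g⁻¹ = (a * m) ^ r * (b * n) ^ s → ⁅g, c⁆ = e := by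
    intro c e r s r₀ s₀ hc he hc' hce hgc
    have h1 : c⁻¹ * (g * c * g⁻¹) ∈ lcs G (i + 1) := by
      rw [conj_eq_mul_commutator, inv_mul_cancel_left]
      exact commutator_mem_lcs hi (inv_mem hc) g
    have hcom : Commute (a * m) (b * n) := hab'
    have h2 : (c * e)⁻¹ * (g * c * g⁻¹) = (a * m) ^ (r - r₀) * (b * n) ^ (s - s₀) := by
      rw [hce, hgc, mul_inv_rev, zpow_sub, zpow_sub]
      have c1 : Commute ((a * m) ^ r₀)⁻¹ ((b * n) ^ s₀)⁻¹ := (hcom.zpow_zpow r₀ s₀).inv_inv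
      have c2 : Commute ((b * n) ^ s₀)⁻¹ ((a * m) ^ r) := (hcom.zpow_zpow r s₀).symm.inv_left
      have c3 : Commute ((a * m) ^ r₀)⁻¹ ((a * m) ^ r) :=
        ((Commute.refl (a * m)).zpow_zpow r₀ r).inv_left
      have c4 : Commute ((b * n) ^ s₀)⁻¹ ((b * n) ^ s) :=
        ((Commute.refl (b * n)).zpow_zpow s₀ s).inv_left
      rw [← c1.eq, mul_assoc, ← mul_assoc ((b * n) ^ s₀)⁻¹, c2.eq, mul_assoc, c4.eq,
        ← mul_assoc, c3.eq]
    have h3 : (c * e)⁻¹ * (g * c * g⁻¹) ∈ lcs G (i + 1) := by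
      rw [mul_inv_rev, mul_assoc]
      exact mul_mem (inv_mem he) h1
    obtain ⟨hr, hs⟩ := hind' _ _ (h2 ▸ h3)
    rw [zpow_eq_one_of_dvd (hp1 _ haa) hr, zpow_eq_one_of_dvd (hp1 _ hbb) hs, one_mul,
      inv_mul_eq_one] at h2
    rw [commutatorElement_def, ← h2, Subgroup.mem_center_iff.1 (hNZ he) c, mul_inv_cancel_right]
  obtain ⟨r, s, h1⟩ := hg a (left_mem_pairSubgroup hab)
  obtain ⟨r', s', h2⟩ := hg b (right_mem_pairSubgroup hab)
  exact ⟨g, fin r s 1 0 ha hm (by simp) (by simp) h1, fin r' s' 0 1 hb hn (by simp) (by simp) h2⟩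

/-- The same argument with the cyclic complements ⟨a⟩ and ⟨am⟩. -/
theorem exists_commutator (h : IsScaling p ℓ α) {i : ℕ} (hi : 1 ≤ i)
    (hbot : lcs G (i + 2) = ⊥) {a : G} (ha : a ∈ lcs G i) (ha' : a ∉ lcs G (i + 1))
    {m : G} (hm : m ∈ lcs G (i + 1)) : ∃ g : G, ⁅g, a⁆ = m := by
  have hi1 : 1 ≤ i + 1 := by omega
  have hp1 : ∀ t ∈ lcs G i, t ^ p = 1 := fun t ht => by
    have := h.pow_mem_lcs hi ht
    rwa [hbot, Subgroup.mem_bot] at this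
  have hle : lcs G (i + 1) ≤ lcs G i := lcs_antitone (Nat.le_succ i)
  have hNZ : lcs G (i + 1) ≤ Subgroup.center G := fun _ ht => mem_center_of_mem_lcs hi1 hbot ht
  have hmZ := Subgroup.mem_center_iff.1 (hNZ hm)
  have haa : a * m ∈ lcs G i := mul_mem ha (hle hm)
  have haa' : a * m ∉ lcs G (i + 1) := fun hc => ha' ((Subgroup.mul_mem_cancel_right _ hm).1 hc)
  have gen : ∀ {c : G} (_ : c ∈ lcs G i) (_ : c ∉ lcs G (i + 1)),
      Subgroup.zpowers c ≤ lcs G i ∧ ∀ x ∈ Subgroup.zpowers c, x ∈ lcs G (i + 1) → x = 1 := by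
    intro c hc hc'
    refine ⟨(Subgroup.zpowers_le).2 hc, ?_⟩
    rintro _ ⟨r, rfl⟩ hx
    refine zpow_eq_one_of_dvd (hp1 c hc) ?_
    by_contra hr
    exact hc' (mem_of_zpow_mem h.isPGroup hx hr)
  obtain ⟨hH, hHN⟩ := gen ha ha'
  obtain ⟨hH', hHN'⟩ := gen haa haa'
  obtain ⟨g, hg⟩ := exists_conj_of_complements (N := lcs G (i + 1)) (m := ℓ ^ (i + 1))
    (k := ℓ ^ i) (H := Subgroup.zpowers a) (H' := Subgroup.zpowers (a * m)) h.isPGroup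
    h.conjStable hNZ (fun _ ht => h.map_eq_zpow hi1 hbot ht) (h.not_dvd_pow_sub' i) hHN
    (fun x hx y => commutator_mem_lcs hi (hH hx) y) (fun x hx => h.map_mem_lcs hi (hH hx)) hHN'
    (fun x hx y => commutator_mem_lcs hi (hH' hx) y) (fun x hx => h.map_mem_lcs hi (hH' hx)) (by
      rintro _ ⟨r, rfl⟩
      refine ⟨(a * m) ^ r, ⟨r, rfl⟩, ?_⟩
      change (a ^ r)⁻¹ * _ ∈ _
      rw [Commute.mul_zpow (hmZ a), inv_mul_cancel_left]
      exact zpow_mem hm r)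
  obtain ⟨r, h1⟩ := hg a (Subgroup.mem_zpowers a)
  have h1 : (a * m) ^ r = g * a * g⁻¹ := h1
  refine ⟨g, ?_⟩
  have h2 : ((a * m) ^ (1 : ℤ))⁻¹ * (a * m) ^ r ∈ lcs G (i + 1) := by
    rw [h1, conj_eq_mul_commutator, zpow_one, mul_inv_rev, mul_assoc, inv_mul_cancel_left]
    exact mul_mem (inv_mem hm) (commutator_mem_lcs hi (inv_mem ha) g)
  have h3 := zpow_eq_zpow_of_dvd (hp1 _ haa) (dvd_sub_of_zpow_mem h.isPGroup haa' h2)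
  rw [zpow_one, h1] at h3
  rw [commutatorElement_def, h3, hmZ a, mul_inv_cancel_right]

end IsScaling

/-! ### Index computations by characters. -/

section Index

variable {G : Type*} [Group G]

/-- A pairing of `G` with a finite abelian group `A` that is trivial on `B ≤ A` has a left kernel
of index at most `|A : B|`. -/
theorem index_ker_le_of_pairing {A : Type*} [CommGroup A] [Finite A] (B : Subgroup A)
    (f : G →* A →* ℂˣ) (hf : ∀ g, ∀ b ∈ B, f g b = 1) : f.ker.index ≤ B.index := by
  have hle : f.range ≤ (MonoidHom.domRestrictHom B ℂˣ).ker := by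
    rintro _ ⟨g, rfl⟩
    ext b
    simpa using congrArg Units.val (hf g b b.2)
  -- A has exactly |A : B| complex characters that are trivial on B.
  have hcard := CommGroup.card_domRestrictHom_ker (M := ℂ) B
  have hfin : Finite (MonoidHom.domRestrictHom B ℂˣ).ker :=
    Nat.finite_of_card_ne_zero (by rw [hcard]; exact Nat.card_pos.ne')
  rw [Subgroup.index_ker, Subgroup.index_eq_card, ← hcard]
  exact Subgroup.card_le_of_le hle

/-- Used to view commutators with values in a G_3 of order p as complex characters of G_2. -/
theorem exists_injective_hom_units {p : ℕ} [Fact p.Prime] {A : Type*} [CommGroup A]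
    (hA : Nat.card A = p) : ∃ ψ : A →* ℂˣ, Function.Injective ψ := by
  have hfin : Finite A :=
    Nat.finite_of_card_ne_zero (by rw [hA]; exact (Fact.out : p.Prime).ne_zero)
  have hnt : Nontrivial A := Finite.one_lt_card_iff_nontrivial.1 (by
    rw [hA]; exact (Fact.out : p.Prime).one_lt)
  obtain ⟨a, ha⟩ := exists_ne (1 : A)
  obtain ⟨ψ, hψ⟩ := CommGroup.exists_apply_ne_one_of_hasEnoughRootsOfUnity A ℂ ha
  refine ⟨ψ, (MonoidHom.ker_eq_bot_iff ψ).1 ?_⟩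
  have : Fact (Nat.card A).Prime := by rw [hA]; infer_instance
  refine (Subgroup.eq_bot_or_eq_top_of_prime_card ψ.ker).resolve_right fun h => hψ ?_
  rw [← MonoidHom.mem_ker, h]
  exact Subgroup.mem_top a

theorem relIndex_zpowers_sup {p : ℕ} [Fact p.Prime] (A : Subgroup G) [A.Normal] {e : G}
    (he : e ∉ A) (hp : e ^ p ∈ A) : A.relIndex (Subgroup.zpowers e ⊔ A) = p := by
  rw [Subgroup.relIndex_sup_right]
  conv_lhs => rw [← QuotientGroup.ker_mk' A]
  rw [Subgroup.relIndex_ker, MonoidHom.map_zpowers, Nat.card_zpowers]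
  refine orderOf_eq_prime ?_ ?_
  · exact (QuotientGroup.eq_one_iff _).2 hp
  · exact fun h => he ((QuotientGroup.eq_one_iff _).1 h)

theorem dvd_of_zpow_mul_zpow_mem {p : ℕ} [Fact p.Prime] (hG : IsPGroup p G) {A : Subgroup G}
    [A.Normal] (hp : ∀ x : G, x ^ p ∈ A) {a b : G} (ha : a ∉ A)
    (hb : b ∉ Subgroup.zpowers a ⊔ A) {r s : ℤ} (h : a ^ r * b ^ s ∈ A) :
    (p : ℤ) ∣ r ∧ (p : ℤ) ∣ s := by
  have hs : (p : ℤ) ∣ s := by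
    by_contra hs
    refine hb (mem_of_zpow_mem hG (i := s) ?_ hs)
    refine (Subgroup.mul_mem_cancel_left _ (zpow_mem (Subgroup.mem_sup_left
      (Subgroup.mem_zpowers a)) r)).1 (Subgroup.mem_sup_right h)
  refine ⟨?_, hs⟩
  by_contra hr
  obtain ⟨c, rfl⟩ := hs
  refine ha (mem_of_zpow_mem hG ((Subgroup.mul_mem_cancel_right _ ?_).1 h) hr)
  rw [zpow_mul, zpow_natCast]
  exact zpow_mem (hp b) c

end Index

/-! ### Elements outside G_2 and their centralisers modulo G_3. -/

namespace IsScaling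

variable {p : ℕ} [Fact p.Prime] {ℓ : ℤ} {G : Type*} [Group G] {α : G →* G}

/-- Power maps on elements outside `G_2` agree modulo `G_3` with the `ℓ`-th power map. -/
theorem map_mem_lcs_three (h : IsScaling p ℓ α) {y : G} (hy : y ∉ lcs G 2) {k : ℤ}
    (hk : (y ^ k)⁻¹ * α y ∈ lcs G 3) : (y ^ ℓ)⁻¹ * α y ∈ lcs G 3 := by
  have h1 : (y ^ ℓ)⁻¹ * y ^ k ∈ lcs G 2 := by
    have := mul_mem (h.map_top y) (inv_mem (lcs_antitone (by omega : 2 ≤ 3) hk))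
    rwa [mul_inv_rev, inv_inv, mul_assoc, mul_inv_cancel_left] at this
  obtain ⟨c, hc⟩ := dvd_sub_of_zpow_mem h.isPGroup hy h1
  have h2 : (y ^ ℓ)⁻¹ * y ^ k ∈ lcs G 3 := by
    rw [← zpow_neg, ← zpow_add, neg_add_eq_sub, hc, zpow_mul, zpow_natCast]
    exact zpow_mem (h.pow_mem_lcs le_rfl (by rw [lcs_one]; exact Subgroup.mem_top y)) c
  have := mul_mem h2 hk
  rwa [mul_assoc, mul_inv_cancel_left] at this

/-- Modulo G_3 the element t is central with eigenvalue ℓ², whereas x and xt with eigenvalue ℓ would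
give t the eigenvalue ℓ too. -/
theorem mem_lcs_three_of_map_mem (h : IsScaling p ℓ α) {x t : G} (ht : t ∈ lcs G 2)
    (hx : (x ^ ℓ)⁻¹ * α x ∈ lcs G 3) (hxt : ((x * t) ^ ℓ)⁻¹ * α (x * t) ∈ lcs G 3) :
    t ∈ lcs G 3 := by
  have hZ : (t : G ⧸ lcs G 3) ∈ Subgroup.center (G ⧸ lcs G 3) :=
    mem_center_of_mem_lcs (by omega : 1 ≤ 2) (lcs_quotient_eq_bot le_rfl) (mk_mem_lcs_of_mem _ ht)
  have hc : Commute (x : G ⧸ lcs G 3) (t : G ⧸ lcs G 3) := Subgroup.mem_center_iff.1 hZ _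
  have ht' := h.map_mem_lcs (by omega : 1 ≤ 2) ht
  rw [← QuotientGroup.eq] at hx hxt ht'
  rw [map_mul, QuotientGroup.mk_zpow, QuotientGroup.mk_mul, QuotientGroup.mk_mul, hc.mul_zpow,
    ← ht', ← hx, QuotientGroup.mk_zpow, QuotientGroup.mk_zpow] at hxt
  have h1 := mul_left_cancel hxt
  rw [← QuotientGroup.eq_one_iff]
  by_contra hne
  have := dvd_sub_of_zpow_eq (h.isPGroup.to_quotient (lcs G 3)) hne h1
  exact h.not_dvd_pow_sub 1 (by simpa using this)

/-- The element g that makes a conjugate of ⟨xv⟩ stable must commute with x modulo G_3, hence with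
x, so ⟨xv⟩ itself is stable. An eigenvector xv built from the different eigenvalues ℓ and m forces v
∈ ⟨x⟩, where v has both of them. -/
theorem eq_one_of_centralizes_aux (h : IsScaling p ℓ α) {x : G} (hx : x ∉ lcs G 2)
    (hC : ∀ g, ⁅x, g⁆ ∈ lcs G 3 → ⁅x, g⁆ = 1) {v : G} (hvZ : v ∈ Subgroup.center G)
    (hv : v ∈ lcs G 3) {m : ℤ} (hm : α v = v ^ m) (hmd : ¬ (p : ℤ) ∣ m - ℓ) {k : ℤ}
    (hk : α x = x ^ k) : v = 1 := by
  have h32 : lcs G 3 ≤ lcs G 2 := lcs_antitone (by omega)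
  have hvc := Subgroup.mem_center_iff.1 hvZ
  obtain ⟨g, l, hl⟩ := h.conjStable.exists_zpow (x * v)
  have hxv : ∀ {i : ℕ}, v ∈ lcs G i → (x * v ∈ lcs G i ↔ x ∈ lcs G i) :=
    fun hvi => Subgroup.mul_mem_cancel_right _ hvi
  have hkd : (p : ℤ) ∣ k - ℓ := by
    have := h.map_top x
    rw [hk] at this
    exact dvd_sub_of_zpow_mem h.isPGroup hx this
  have hcomm : ⁅x⁻¹, g⁆ ∈ lcs G 3 := by
    refine (Subgroup.mul_mem_cancel_right (lcs G 3) hv).1 ?_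
    have e : g * (x * v) * g⁻¹ = x * (⁅x⁻¹, g⁆ * v) := by
      rw [← mul_assoc g, mul_assoc (g * x), ← hvc g⁻¹, ← mul_assoc, conj_eq_mul_commutator,
        mul_assoc]
    refine h.mem_lcs_three_of_map_mem (x := x)
      (mul_mem (commutator_mem_lcs_two x⁻¹ g) (h32 hv)) ?_ ?_
    · refine h.map_mem_lcs_three hx (k := k) ?_
      rw [hk, inv_mul_cancel]
      exact one_mem _
    · rw [← e]
      refine h.map_mem_lcs_three (k := l) ?_ ?_
      · rwa [conj_mem_lcs_iff, hxv (h32 hv)]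
      · rw [hl, inv_mul_cancel]
        exact one_mem _
  have hxg : Commute x g := by
    rw [← commutatorElement_eq_one_iff_commute]
    refine hC g ?_
    exact (commutator_inv_mem_lcs_iff x g).1 hcomm
  have e : g * (x * v) * g⁻¹ = x * v := by
    rw [← mul_assoc, ← hxg.eq, mul_assoc x, hvc g, mul_assoc, mul_inv_cancel_right]
  have hxv' : x * v ∉ lcs G 2 := by rwa [hxv (h32 hv)]
  rw [e] at hl
  have hld : (p : ℤ) ∣ l - ℓ := by
    have := h.map_top (x * v)
    rw [hl] at this
    exact dvd_sub_of_zpow_mem h.isPGroup hxv' this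
  have hc : Commute x v := hvc x
  rw [map_mul, hk, hm, hc.mul_zpow] at hl
  have h1 : (x ^ l)⁻¹ * x ^ k = v ^ (l - m) := by
    rw [inv_mul_eq_iff_eq_mul, zpow_sub, ← mul_assoc, eq_mul_inv_iff_mul_eq, hl]
  have hlm : ¬ (p : ℤ) ∣ l - m := fun hd => hmd (by
    have := dvd_sub hld hd
    rwa [show l - ℓ - (l - m) = m - ℓ by ring] at this)
  have h2 : v ∈ Subgroup.zpowers x := by
    refine mem_of_zpow_mem h.isPGroup (i := l - m) ?_ hlm
    rw [← h1]
    exact mul_mem (inv_mem ⟨l, rfl⟩) ⟨k, rfl⟩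
  obtain ⟨j, hj⟩ := h2
  have hj : x ^ j = v := hj
  have h3 : v ^ k = v ^ m := by
    rw [← hm, ← hj, map_zpow, hk, ← zpow_mul, ← zpow_mul, mul_comm]
  by_contra hv1
  have := dvd_add (dvd_sub_of_zpow_eq h.isPGroup hv1 h3) hkd
  rw [show m - k + (k - ℓ) = m - ℓ by ring] at this
  exact hmd this

/-- A reduction to the case that x is an eigenvector: the condition on commutators of x is invariant
under conjugation. -/
theorem eq_one_of_centralizes (h : IsScaling p ℓ α) {x : G} (hx : x ∉ lcs G 2)
    (hC : ∀ g, ⁅x, g⁆ ∈ lcs G 3 → ⁅x, g⁆ = 1) {v : G} (hvZ : v ∈ Subgroup.center G)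
    (hv : v ∈ lcs G 3) {m : ℤ} (hm : α v = v ^ m) (hmd : ¬ (p : ℤ) ∣ m - ℓ) : v = 1 := by
  obtain ⟨g₀, k, hk⟩ := h.conjStable.exists_zpow x
  refine h.eq_one_of_centralizes_aux (x := g₀ * x * g₀⁻¹) ?_ (fun g hg => ?_) hvZ hv hm hmd hk
  · rwa [conj_mem_lcs_iff]
  · have e : ⁅g₀ * x * g₀⁻¹, g⁆ = g₀ * ⁅x, g₀⁻¹ * g * g₀⁆ * g₀⁻¹ := by
      rw [conjugate_commutatorElement]
      congr 1
      group
    rw [e, conj_mem_lcs_iff] at hg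
    rw [e, hC _ hg]
    simp

theorem exists_commutator_pair_mod (h : IsScaling p ℓ α) {N : Subgroup G} [N.Normal]
    (h3 : lcs G 3 ≤ N) (h2 : N ≤ lcs G 2) {a b : G} (ha : a ∉ lcs G 2)
    (hb : b ∉ Subgroup.zpowers a ⊔ lcs G 2) (hab : ⁅a, b⁆ ∈ N) {z w : G} (hz : z ∈ lcs G 2)
    (hw : w ∈ lcs G 2) : ∃ g : G, ⁅g, a⁆⁻¹ * z ∈ N ∧ ⁅g, b⁆⁻¹ * w ∈ N := by
  have htop : ∀ x : G ⧸ N, x ∈ lcs (G ⧸ N) 1 := fun x => by rw [lcs_one]; exact Subgroup.mem_top x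
  obtain ⟨g, hg1, hg2⟩ := (h.quotient N).exists_commutator_pair le_rfl
    (lcs_quotient_eq_bot h3) (htop a) (htop b)
    (commutatorElement_eq_one_iff_commute.1 ((QuotientGroup.eq_one_iff _).2 hab))
    (fun r s hrs => dvd_of_zpow_mul_zpow_mem h.isPGroup h.pow_mem ha hb
      ((mk_mem_lcs_iff (i := 2) h2).1 hrs))
    (mk_mem_lcs_of_mem N hz) (mk_mem_lcs_of_mem N hw)
  induction g using QuotientGroup.induction_on with
  | H g =>
    exact ⟨g, QuotientGroup.eq.1 hg1, QuotientGroup.eq.1 hg2⟩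

/-- In class `2`, the centraliser of an element outside `G_2` has index `|G_2|`. -/
theorem index_centralizer (h : IsScaling p ℓ α) (hbot : lcs G 3 = ⊥) {x : G} (hx : x ∉ lcs G 2) :
    (Subgroup.centralizer {x}).index = Nat.card (lcs G 2) := by
  have hc : ∀ g, ⁅x, g⁆ ∈ Subgroup.center G := fun g =>
    mem_center_of_mem_lcs (by omega) hbot (commutator_mem_lcs_two x g)
  have hker : (commHom x hc).ker = Subgroup.centralizer {x} := by
    ext g
    rw [MonoidHom.mem_ker, commHom_apply, commutatorElement_eq_one_iff_mul_comm,
      Subgroup.mem_centralizer_singleton_iff, eq_comm]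
  have hrange : (commHom x hc).range = lcs G 2 := by
    refine le_antisymm ?_ fun z hz => ?_
    · rintro _ ⟨g, rfl⟩
      exact commutator_mem_lcs_two x g
    · obtain ⟨g, hg⟩ := h.exists_commutator le_rfl hbot (a := x)
        (by rw [lcs_one]; exact Subgroup.mem_top x) hx (inv_mem hz)
      exact ⟨g, by rw [commHom_apply, ← commutatorElement_inv, hg, inv_inv]⟩
  rw [← hker, Subgroup.index_ker, hrange]

/-- The preimage in `G` of the centraliser of `x` in `G / G_3`. -/
def centralizerMod (x : G) : Subgroup G :=
  (Subgroup.centralizer {(x : G ⧸ lcs G 3)}).comap (QuotientGroup.mk' (lcs G 3))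

theorem mem_centralizerMod {G : Type*} [Group G] {x g : G} :
    g ∈ centralizerMod x ↔ ⁅x, g⁆ ∈ lcs G 3 := by
  rw [centralizerMod, Subgroup.mem_comap, Subgroup.mem_centralizer_singleton_iff, eq_comm,
    ← commutatorElement_eq_one_iff_mul_comm, ← QuotientGroup.eq_one_iff]
  rfl

theorem index_centralizerMod (h : IsScaling p ℓ α) {x : G} (hx : x ∉ lcs G 2) :
    (centralizerMod x).index = (lcs G 3).relIndex (lcs G 2) := by
  have h32 : lcs G 3 ≤ lcs G 2 := lcs_antitone (by omega)
  rw [centralizerMod, Subgroup.index_comap_of_surjective _ (QuotientGroup.mk'_surjective _),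
    (h.quotient (lcs G 3)).index_centralizer (lcs_quotient_eq_bot le_rfl)
      (by rwa [mk_mem_lcs_iff h32]), lcs_quotient, ← Subgroup.relIndex_ker, QuotientGroup.ker_mk']

end IsScaling

namespace IsScaling

variable {p : ℕ} [Fact p.Prime] {ℓ : ℤ} {G : Type*} [Group G] {α : G →* G}

theorem lcs_two_le_centralizerMod (x : G) : lcs G 2 ≤ centralizerMod x := by
  intro t ht
  rw [mem_centralizerMod, ← commutatorElement_inv]
  exact inv_mem (commutator_mem_lcs (by omega) ht x)

/-! ### Class three: the first two widths, and ℓ ≡ -1. -/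

section ClassThree

/-- Commutation pairs G with the abelian group G_2, with values in the group G_3 of order p. It is
trivial on G_3 and has left kernel the centraliser of G_2. -/
theorem index_centralizer_lcs_two_le [Finite G] (hbot : lcs G 4 = ⊥)
    (hcard : Nat.card (lcs G 3) = p) :
    (Subgroup.centralizer (lcs G 2 : Set G)).index ≤ (lcs G 3).relIndex (lcs G 2) := by
  have h2 : ⁅lcs G 2, lcs G 2⁆ = ⊥ := by
    rw [eq_bot_iff, ← hbot]
    exact commutator_lcs_lcs_two_le (by omega)
  have hcomm : ∀ a b : lcs G 2, a * b = b * a := fun a b => Subtype.ext (by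
    have : ⁅(a : G), (b : G)⁆ ∈ ⁅lcs G 2, lcs G 2⁆ := Subgroup.commutator_mem_commutator a.2 b.2
    rw [h2, Subgroup.mem_bot, commutatorElement_eq_one_iff_mul_comm] at this
    exact this)
  have hZ : ∀ t ∈ lcs G 3, t ∈ Subgroup.center G := fun t ht =>
    mem_center_of_mem_lcs (by omega) hbot ht
  have hcomm3 : ∀ a b : lcs G 3, a * b = b * a := fun a b =>
    Subtype.ext (Subgroup.mem_center_iff.1 (hZ b b.2) a)
  let _ : CommGroup (lcs G 2) := { (inferInstance : Group (lcs G 2)) with mul_comm := hcomm }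
  let _ : CommGroup (lcs G 3) := { (inferInstance : Group (lcs G 3)) with mul_comm := hcomm3 }
  obtain ⟨ψ, hψ⟩ := exists_injective_hom_units hcard
  have hmem : ∀ (g : G) (t : lcs G 2), ⁅(t : G), g⁆ ∈ lcs G 3 := fun g t =>
    commutator_mem_lcs (by omega) t.2 g
  let f : G →* lcs G 2 →* ℂˣ :=
    { toFun := fun g =>
        { toFun := fun t => ψ ⟨⁅(t : G), g⁆, hmem g t⟩
          map_one' := by
            rw [← map_one ψ]
            congr 1
            exact Subtype.ext (commutatorElement_one_left g)
          map_mul' := fun a b => by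
            rw [← map_mul ψ]
            congr 1
            exact Subtype.ext (commutator_mul_left (hZ _ (hmem g b))) }
      map_one' := by
        ext t
        have e : (⟨⁅(t : G), (1 : G)⁆, hmem 1 t⟩ : lcs G 3) = 1 :=
          Subtype.ext (commutatorElement_one_right _)
        exact congrArg Units.val ((congrArg ψ e).trans (map_one ψ))
      map_mul' := fun a b => by
        ext t
        change (ψ ⟨⁅(t : G), a * b⁆, _⟩ : ℂ) = ψ ⟨⁅(t : G), a⁆, _⟩ * ψ ⟨⁅(t : G), b⁆, _⟩
        rw [← Units.val_mul, ← map_mul ψ]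
        congr 2
        exact Subtype.ext (commutator_mul_right (hZ _ (hmem b t))) }
  have hker : f.ker = Subgroup.centralizer (lcs G 2 : Set G) := by
    ext g
    rw [MonoidHom.mem_ker, Subgroup.mem_centralizer_iff]
    constructor
    · intro hg t ht
      have h1 : ψ ⟨⁅t, g⁆, hmem g ⟨t, ht⟩⟩ = 1 := DFunLike.congr_fun hg ⟨t, ht⟩
      rw [map_eq_one_iff ψ hψ] at h1
      exact commutatorElement_eq_one_iff_mul_comm.1 (congrArg Subtype.val h1)
    · intro hg
      ext t
      change (ψ ⟨⁅(t : G), g⁆, _⟩ : ℂ) = 1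
      rw [← Units.val_one, ← map_one ψ]
      congr 2
      exact Subtype.ext (commutatorElement_eq_one_iff_mul_comm.2 (hg t t.2))
  rw [← hker]
  refine index_ker_le_of_pairing ((lcs G 3).subgroupOf (lcs G 2)) f fun g b hb => ?_
  change ψ ⟨⁅(b : G), g⁆, _⟩ = 1
  rw [← map_one ψ]
  congr 1
  exact Subtype.ext (commutatorElement_eq_one_iff_mul_comm.2
    (Subgroup.mem_center_iff.1 (hZ _ hb) g).symm)

/-- By the three subgroups lemma [C, C] is central, and the eigenvalue argument places central
elements of G_2 in G_3. -/
theorem commutator_centralizer_lcs_two_mem (h : IsScaling p ℓ α) (hbot : lcs G 4 = ⊥)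
    (hne : lcs G 3 ≠ ⊥) {a b : G} (ha : a ∈ Subgroup.centralizer (lcs G 2 : Set G))
    (hb : b ∈ Subgroup.centralizer (lcs G 2 : Set G)) : ⁅a, b⁆ ∈ lcs G 3 := by
  set C := Subgroup.centralizer (lcs G 2 : Set G) with hC
  have h0 : ⁅lcs G 2, C⁆ = ⊥ := by
    rw [Subgroup.commutator_comm]
    exact Subgroup.commutator_eq_bot_iff_le_centralizer.2 le_rfl
  have hle : ∀ H K : Subgroup G, ⁅H, K⁆ ≤ lcs G 2 := fun H K =>
    Subgroup.commutator_mono le_top le_top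
  have h1 : ∀ H K : Subgroup G, ⁅⁅H, K⁆, C⁆ = ⊥ := fun H K => by
    rw [eq_bot_iff, ← h0]
    exact Subgroup.commutator_mono (hle H K) le_rfl
  have h2 : ⁅⁅C, C⁆, (⊤ : Subgroup G)⁆ = ⊥ :=
    Subgroup.commutator_commutator_eq_bot_of_rotate (h1 _ _) (h1 _ _)
  refine h.mem_lcs_succ_of_mem_center (by omega) hbot hne (commutator_mem_lcs_two a b) ?_
  exact (Subgroup.commutator_top_right_eq_bot_iff_le_center.1 h2)
    (Subgroup.commutator_mem_commutator ha hb)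

/-- For y ∉ C and N = ⟨[c,y]⟩G_3, the elements c and y commute modulo N. So any w ∈ G_2 is [g,y]
modulo N for some g centralising c modulo N, and such a g turns out to have [g,y] ∈ N. -/
theorem exists_lcs_two_eq (h : IsScaling p ℓ α)
    (hne : lcs G 3 ≠ ⊥) {c : G} (hc2 : c ∉ lcs G 2)
    (hcC : centralizerMod c = Subgroup.centralizer (lcs G 2 : Set G))
    (hC : Subgroup.centralizer (lcs G 2 : Set G) = Subgroup.zpowers c ⊔ lcs G 2) :
    ∃ e ∉ lcs G 3, lcs G 2 = Subgroup.zpowers e ⊔ lcs G 3 := by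
  have h32 : lcs G 3 ≤ lcs G 2 := lcs_antitone (by omega)
  obtain ⟨y, hy⟩ : ∃ y, y ∉ Subgroup.centralizer (lcs G 2 : Set G) := by
    by_contra hcon
    push Not at hcon
    refine hne (eq_bot_iff.2 (lcs_succ_le (by omega) fun t ht g => ?_))
    rw [Subgroup.mem_bot, commutatorElement_eq_one_iff_mul_comm]
    exact Subgroup.mem_centralizer_iff.1 (hcon g) t ht
  have he : ⁅c, y⁆ ∉ lcs G 3 := by rwa [← mem_centralizerMod, hcC]
  refine ⟨⁅c, y⁆, he, ?_⟩
  set N := Subgroup.zpowers ⁅c, y⁆ ⊔ lcs G 3 with hN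
  have hN2 : N ≤ lcs G 2 := sup_le (Subgroup.zpowers_le.2 (commutator_mem_lcs_two c y)) h32
  have h3N : lcs G 3 ≤ N := le_sup_right
  have hNn : N.Normal := by
    refine Subgroup.commutator_top_right_le_iff.1 ((Subgroup.commutator_mono hN2 le_rfl).trans ?_)
    rw [← lcs_succ (by omega)]
    exact h3N
  refine le_antisymm (fun w hw => ?_) hN2
  have heN : ⁅c, y⁆ ∈ N := Subgroup.mem_sup_left (Subgroup.mem_zpowers _)
  obtain ⟨g, hg1, hg2⟩ := h.exists_commutator_pair_mod h3N hN2 hc2 (hC ▸ hy) heN (one_mem _) hw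
  refine (Subgroup.mul_mem_cancel_left _ (inv_mem ?_)).1 hg2
  have hZ : ∀ a b : G, ⁅(a : G ⧸ lcs G 3), (b : G ⧸ lcs G 3)⁆ ∈ Subgroup.center (G ⧸ lcs G 3) :=
    fun a b => mem_center_of_mem_lcs (by omega : 1 ≤ 2) (lcs_quotient_eq_bot le_rfl)
      (commutator_mem_lcs_two _ _)
  have hg1' : ⁅g, c⁆ ∈ N := by rwa [mul_one, inv_mem_iff] at hg1
  obtain ⟨_, ⟨i, rfl⟩, r, hr, hir⟩ := Subgroup.mem_sup_of_normal_right.1 hg1'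
  -- A power of y corrects g so that it centralises c modulo G_3, not merely modulo N; the product
  -- then lies in C = ⟨c⟩G_2.
  have hgi : y ^ i * g ∈ centralizerMod c := by
    rw [mem_centralizerMod, ← QuotientGroup.eq_one_iff]
    change ⁅(c : G ⧸ lcs G 3), ((y ^ i * g : G) : G ⧸ lcs G 3)⁆ = 1
    rw [QuotientGroup.mk_mul, QuotientGroup.mk_zpow, commutator_mul_right (hZ c g),
      commutator_zpow_right (hZ c y), mul_eq_one_iff_eq_inv, commutatorElement_inv]
    have := congrArg (QuotientGroup.mk (s := lcs G 3)) hir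
    rw [QuotientGroup.mk_mul, (QuotientGroup.eq_one_iff r).2 hr, mul_one] at this
    exact this
  rw [hcC, hC] at hgi
  obtain ⟨_, ⟨j, rfl⟩, s, hs, hjs⟩ := Subgroup.mem_sup_of_normal_right.1 hgi
  have hgy : (⁅c, y⁆ ^ j)⁻¹ * ⁅g, y⁆ ∈ lcs G 3 := by
    rw [← QuotientGroup.eq]
    have hg' : g = y ^ (-i) * (c ^ j * s) := by
      have hjs : c ^ j * s = y ^ i * g := hjs
      rw [hjs, zpow_neg, inv_mul_cancel_left]
    have hs1 : ⁅(s : G ⧸ lcs G 3), (y : G ⧸ lcs G 3)⁆ = 1 :=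
      (QuotientGroup.eq_one_iff _).2 (commutator_mem_lcs (by omega : 1 ≤ 2) hs y)
    change ((⁅c, y⁆ ^ j : G) : G ⧸ lcs G 3) = ⁅(g : G ⧸ lcs G 3), (y : G ⧸ lcs G 3)⁆
    have e1 : ⁅(y : G ⧸ lcs G 3) ^ (-i), (y : G ⧸ lcs G 3)⁆ = 1 :=
      commutatorElement_eq_one_iff_commute.2 ((Commute.refl _).zpow_left _)
    have e2 : ⁅((c ^ j * s : G) : G ⧸ lcs G 3), (y : G ⧸ lcs G 3)⁆ =
        ⁅(c : G ⧸ lcs G 3), (y : G ⧸ lcs G 3)⁆ ^ j := by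
      rw [QuotientGroup.mk_mul, commutator_mul_left (hZ s y), hs1, mul_one, QuotientGroup.mk_zpow,
        commutator_zpow_left (hZ c y)]
    rw [hg', QuotientGroup.mk_mul, commutator_mul_left (hZ _ y), e2, QuotientGroup.mk_zpow,
      QuotientGroup.mk_zpow, e1, one_mul]
    rfl
  refine (Subgroup.mul_mem_cancel_left _ (inv_mem (zpow_mem heN j))).1 (h3N hgy)

variable [Finite G]

/-- If C lies in the centraliser modulo G_3 of some x ∉ G_2, the two coincide, by the bound on
|G:C|. Were C ≤ G_2, this would hold for every x ∉ G_2 and put x into C. -/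
theorem exists_mem_centralizer_lcs_two (h : IsScaling p ℓ α) (hbot : lcs G 4 = ⊥)
    (hcard : Nat.card (lcs G 3) = p) (hne : lcs G 3 ≠ ⊥) :
    ∃ c ∈ Subgroup.centralizer (lcs G 2 : Set G), c ∉ lcs G 2 ∧
      centralizerMod c = Subgroup.centralizer (lcs G 2 : Set G) := by
  set C := Subgroup.centralizer (lcs G 2 : Set G) with hC
  have hidx : C.index ≤ _ := index_centralizer_lcs_two_le hbot hcard
  have key : ∀ x, x ∉ lcs G 2 → C ≤ centralizerMod x → centralizerMod x = C := by
    intro x hx hle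
    refine (Subgroup.eq_of_le_of_card_ge hle ?_).symm
    have e1 := C.card_mul_index
    have e2 := (centralizerMod x).card_mul_index
    rw [h.index_centralizerMod hx] at e2
    by_contra hlt
    push Not at hlt
    have : Nat.card C * C.index < Nat.card (centralizerMod x) * (lcs G 3).relIndex (lcs G 2) :=
      Nat.mul_lt_mul_of_lt_of_le hlt hidx (Nat.pos_of_ne_zero (by
        have := C.index_ne_zero_of_finite; omega))
    omega
  have hle2 : lcs G 2 ≤ C := by
    rw [hC, ← Subgroup.commutator_eq_bot_iff_le_centralizer, eq_bot_iff, ← hbot]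
    exact commutator_lcs_lcs_two_le (by omega)
  obtain ⟨c, hc, hc2⟩ : ∃ c ∈ C, c ∉ lcs G 2 := by
    by_contra hcon
    push Not at hcon
    have hnil : Group.IsNilpotent G := h.isPGroup.isNilpotent
    have hlt : lcs G 2 < lcs G 1 := lcs_lt_of_ne_bot le_rfl fun h1 =>
      hne (eq_bot_iff.2 ((lcs_antitone (by omega)).trans h1.le))
    obtain ⟨x, -, hx⟩ := SetLike.exists_of_lt hlt
    have h1 := key x hx (le_trans (show C ≤ lcs G 2 from hcon) (lcs_two_le_centralizerMod x))
    refine hx (hcon x ?_)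
    rw [← h1, mem_centralizerMod, commutatorElement_self]
    exact one_mem _
  refine ⟨c, hc, hc2, key c hc2 fun g hg => ?_⟩
  rw [mem_centralizerMod]
  exact h.commutator_centralizer_lcs_two_mem hbot hne hc hg

/-- If b ∈ C were independent of c, some g would centralise c modulo G_3 with [g,b] any prescribed
element of G_2 modulo G_3. But then g ∈ C, so [g,b] ∈ G_3. -/
theorem centralizer_lcs_two_eq (h : IsScaling p ℓ α) (hbot : lcs G 4 = ⊥)
    (hne : lcs G 3 ≠ ⊥) {c : G} (hc : c ∈ Subgroup.centralizer (lcs G 2 : Set G))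
    (hc2 : c ∉ lcs G 2) (hcC : centralizerMod c = Subgroup.centralizer (lcs G 2 : Set G)) :
    Subgroup.centralizer (lcs G 2 : Set G) = Subgroup.zpowers c ⊔ lcs G 2 := by
  have hnil : Group.IsNilpotent G := h.isPGroup.isNilpotent
  have hlt : lcs G 3 < lcs G 2 := lcs_lt_of_ne_bot (by omega) fun h1 =>
      hne (eq_bot_iff.2 ((lcs_antitone (by omega)).trans h1.le))
  refine le_antisymm (fun b hb => ?_) (sup_le (Subgroup.zpowers_le.2 hc) ?_)
  · by_contra hcb
    obtain ⟨w, hw, hw3⟩ := SetLike.exists_of_lt hlt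
    obtain ⟨g, hg1, hg2⟩ := h.exists_commutator_pair_mod (N := lcs G 3) le_rfl hlt.le hc2 hcb
      (h.commutator_centralizer_lcs_two_mem hbot hne hc hb) (one_mem _) hw
    have hg : g ∈ centralizerMod c := by
      rw [mem_centralizerMod, ← commutatorElement_inv]
      simpa using hg1
    rw [hcC] at hg
    refine hw3 ((Subgroup.mul_mem_cancel_left _ (inv_mem ?_)).1 hg2)
    exact h.commutator_centralizer_lcs_two_mem hbot hne hg hb
  · rw [← hcC]
    exact lcs_two_le_centralizerMod c

theorem class_three_aux (h : IsScaling p ℓ α) (hbot : lcs G 4 = ⊥)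
    (hcard : Nat.card (lcs G 3) = p) :
    (lcs G 2).index = p ^ 2 ∧ (lcs G 3).relIndex (lcs G 2) = p ∧ (p : ℤ) ∣ ℓ + 1 := by
  have hne : lcs G 3 ≠ ⊥ := fun h0 => by
    rw [h0, Subgroup.card_bot] at hcard
    exact (Fact.out : p.Prime).one_lt.ne hcard
  obtain ⟨c, hc, hc2, hcC⟩ := h.exists_mem_centralizer_lcs_two hbot hcard hne
  have hC := h.centralizer_lcs_two_eq hbot hne hc hc2 hcC
  obtain ⟨e, he, h2⟩ := h.exists_lcs_two_eq hne hc2 hcC hC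
  have hrel : (lcs G 3).relIndex (lcs G 2) = p := by
    rw [h2]
    refine relIndex_zpowers_sup _ he (h.pow_mem_lcs_succ (by omega) ?_)
    rw [h2]
    exact Subgroup.mem_sup_left (Subgroup.mem_zpowers e)
  refine ⟨?_, hrel, ?_⟩
  · rw [← Subgroup.relIndex_mul_index (le_sup_right : lcs G 2 ≤ Subgroup.zpowers c ⊔ lcs G 2),
      relIndex_zpowers_sup _ hc2 (h.pow_mem c), ← hC, ← hcC, h.index_centralizerMod hc2, hrel, sq]
  -- All of C = ⟨c⟩G_2 commutes with c, so `eq_one_of_centralizes` would kill G_3 unless its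
  -- eigenvalue ℓ^3 is congruent to ℓ.
  · by_contra hd
    refine hne (eq_bot_iff.2 fun v hv => Subgroup.mem_bot.2 ?_)
    refine h.eq_one_of_centralizes hc2 (fun g hg => ?_)
      (mem_center_of_mem_lcs (by omega) hbot hv) hv (h.map_eq_zpow (by omega) hbot hv) ?_
    · rw [← mem_centralizerMod, hcC, hC] at hg
      obtain ⟨_, ⟨i, rfl⟩, r, hr, rfl⟩ := Subgroup.mem_sup_of_normal_right.1 hg
      rw [commutatorElement_eq_one_iff_commute]
      exact ((Commute.refl c).zpow_right i).mul_right
        (Subgroup.mem_centralizer_iff.1 hc r hr).symm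
    · rw [show ℓ ^ 3 - ℓ = ℓ * ((ℓ - 1) * (ℓ + 1)) by ring]
      have hp := Nat.prime_iff_prime_int.1 (Fact.out : p.Prime)
      intro hdvd
      rcases hp.dvd_or_dvd hdvd with h1 | h1
      · exact h.not_dvd h1
      rcases hp.dvd_or_dvd h1 with h1 | h1
      · exact h.not_dvd_sub_one h1
      · exact hd h1

/-- Dividing by a normal subgroup M with G_4 ≤ M ≤ G_3 of index p in G_3 leaves the first two layers
unchanged. -/
theorem class_three (h : IsScaling p ℓ α) (hne : lcs G 3 ≠ ⊥) :
    (lcs G 2).index = p ^ 2 ∧ (lcs G 3).relIndex (lcs G 2) = p ∧ (p : ℤ) ∣ ℓ + 1 := by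
  have hnil : Group.IsNilpotent G := h.isPGroup.isNilpotent
  obtain ⟨M, hMn, h4M, hM3, hMp, -⟩ := exists_relIndex_eq_prime h.isPGroup
    (lcs_lt_of_ne_bot (by omega) hne) (lcs_succ (G := G) (by omega : 1 ≤ 3)).ge
  have hM2 : M ≤ lcs G 2 := hM3.trans (lcs_antitone (by omega))
  have key := (h.quotient M).class_three_aux (lcs_quotient_eq_bot h4M) (by
    rw [lcs_quotient, ← Subgroup.relIndex_ker, QuotientGroup.ker_mk', hMp])
  rw [relIndex_lcs_quotient hM3] at key
  rwa [← comap_lcs_quotient hM2,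
    Subgroup.index_comap_of_surjective _ (QuotientGroup.mk'_surjective M),
    comap_lcs_quotient hM2]

end ClassThree

end IsScaling

section Index

variable {p : ℕ} [Fact p.Prime] {G : Type*} [Group G]

theorem eq_zpowers_sup_of_relIndex_eq {A B : Subgroup G} [A.Normal] (hAB : A ≤ B)
    (hp : A.relIndex B = p) {e : G} (heB : e ∈ B) (he : e ∉ A) (hep : e ^ p ∈ A) :
    B = Subgroup.zpowers e ⊔ A := by
  have hle : Subgroup.zpowers e ⊔ A ≤ B := sup_le (Subgroup.zpowers_le.2 heB) hAB
  refine le_antisymm ?_ hle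
  have h1 := Subgroup.relIndex_mul_relIndex A _ B le_sup_right hle
  rw [relIndex_zpowers_sup A he hep, hp] at h1
  rw [← Subgroup.relIndex_eq_one]
  exact Nat.eq_of_mul_eq_mul_left (Fact.out : p.Prime).pos (h1.trans (mul_one p).symm)

theorem eq_of_le_of_index_eq_prime {H K : Subgroup G} (hH : H.index = p) (hle : H ≤ K)
    (hK : K ≠ ⊤) : K = H := by
  have h1 := Subgroup.relIndex_mul_index hle
  rw [hH] at h1
  have hp := (Fact.out : p.Prime)
  rcases (Nat.dvd_prime hp).1 (Dvd.intro_left _ h1) with h2 | h2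
  · exact absurd (Subgroup.index_eq_one.1 h2) hK
  · rw [h2] at h1
    refine le_antisymm (Subgroup.relIndex_eq_one.1 ?_) hle
    exact Nat.eq_of_mul_eq_mul_right hp.pos (h1.trans (one_mul p).symm)

theorem mul_pow_of_commutator_mem_center {x t : G} (hc : ⁅t, x⁆ ∈ Subgroup.center G) (n : ℕ) :
    (x * t) ^ n = x ^ n * t ^ n * ⁅t, x⁆ ^ n.choose 2 := by
  have hcc := Subgroup.mem_center_iff.1 hc
  have hcc' : ∀ k : ℕ, ∀ g, g * ⁅t, x⁆ ^ k = ⁅t, x⁆ ^ k * g := fun k =>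
    Subgroup.mem_center_iff.1 (pow_mem hc k)
  induction n with
  | zero => simp
  | succ n ih =>
    have h1 : t ^ n * x = ⁅t, x⁆ ^ n * x * t ^ n := by
      have := commutator_zpow_left hc n
      rw [zpow_natCast, zpow_natCast, commutatorElement_def] at this
      rw [← this]
      group
    rw [Nat.choose_succ_succ', Nat.choose_one_right, pow_succ, ih]
    calc x ^ n * t ^ n * ⁅t, x⁆ ^ n.choose 2 * (x * t)
        = x ^ n * (t ^ n * x) * t * ⁅t, x⁆ ^ n.choose 2 := by
          rw [mul_assoc _ _ (x * t), ← hcc']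
          simp only [mul_assoc]
      _ = x ^ n * (⁅t, x⁆ ^ n * (x * t ^ n)) * t * ⁅t, x⁆ ^ n.choose 2 := by
          rw [h1]
          simp only [mul_assoc]
      _ = x ^ (n + 1) * t ^ (n + 1) * ⁅t, x⁆ ^ (n + n.choose 2) := by
          rw [← hcc' n, pow_succ, pow_succ, pow_add]
          simp only [mul_assoc]
          congr 3
          rw [← mul_assoc, ← hcc' n, mul_assoc]

end Index

/-! ### Class four: the third and fourth widths, and p-th powers. -/

namespace IsScaling

variable {p : ℕ} {ℓ : ℤ} {G : Type*} [Group G] {α : G →* G}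

theorem not_dvd_two (h : IsScaling p (-1) α) : ¬ (p : ℤ) ∣ 2 := by
  have := h.not_dvd_sub_one
  rwa [show (-1 - 1 : ℤ) = -2 by norm_num, dvd_neg] at this

/-- The situation in class exactly `4`: the `p`-group `G` has an endomorphism that stabilises
conjugates of subgroups and inverts `G / G_2`, and the first two widths are `2` and `1`. -/
structure IsClassFour (p : ℕ) {G : Type*} [Group G] (α : G →* G) : Prop where
  scaling : IsScaling p (-1) α
  bot : lcs G 5 = ⊥
  ne_bot : lcs G 4 ≠ ⊥
  index_two : (lcs G 2).index = p ^ 2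
  relIndex_two : (lcs G 3).relIndex (lcs G 2) = p

namespace IsClassFour

theorem mem_center (h : IsClassFour p α) {v : G} (hv : v ∈ lcs G 4) : v ∈ Subgroup.center G :=
  mem_center_of_mem_lcs (by omega) h.bot hv

theorem map_four (h : IsClassFour p α) {v : G} (hv : v ∈ lcs G 4) : α v = v := by
  simpa using h.scaling.map_eq_zpow (by omega : 1 ≤ 4) h.bot hv

variable [Fact p.Prime]

theorem eq_one_of_zpow_eq (h : IsClassFour p α) {v : G} {k : ℤ} (hk : (p : ℤ) ∣ k + 1)
    (hv : v = v ^ k) : v = 1 := by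
  by_contra hne
  have h1 := dvd_sub_of_zpow_eq h.scaling.isPGroup hne ((zpow_one v).trans hv)
  have := dvd_sub hk h1
  rw [show k + 1 - (k - 1) = 2 by ring] at this
  exact h.scaling.not_dvd_two this

theorem lcs_two_eq (h : IsClassFour p α) {z : G} (hz : z ∈ lcs G 2) (hz3 : z ∉ lcs G 3) :
    lcs G 2 = Subgroup.zpowers z ⊔ lcs G 3 :=
  eq_zpowers_sup_of_relIndex_eq (lcs_antitone (by omega)) h.relIndex_two hz hz3
    (h.scaling.pow_mem_lcs_succ (by omega) hz)

theorem exists_mem_lcs_two (h : IsClassFour p α) : ∃ z ∈ lcs G 2, z ∉ lcs G 3 := by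
  by_contra hcon
  push Not at hcon
  have := h.relIndex_two
  rw [Subgroup.relIndex_eq_one.2 hcon] at this
  exact (Fact.out : p.Prime).one_lt.ne this

theorem index_zpowers_sup (h : IsClassFour p α) {x : G} (hx : x ∉ lcs G 2) :
    (Subgroup.zpowers x ⊔ lcs G 2).index = p := by
  have h1 := Subgroup.relIndex_mul_index (le_sup_right : lcs G 2 ≤ Subgroup.zpowers x ⊔ lcs G 2)
  rw [relIndex_zpowers_sup _ hx (h.scaling.pow_mem x), h.index_two, sq] at h1
  exact Nat.eq_of_mul_eq_mul_left (Fact.out : p.Prime).pos h1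

/-- G_2 is generated by one element z together with G_3, and [G_3, G_2] ≤ G_5 = 1. -/
theorem commute (h : IsClassFour p α) {a b : G} (ha : a ∈ lcs G 2) (hb : b ∈ lcs G 2) :
    Commute a b := by
  have h3 : lcs G 3 ≤ Subgroup.centralizer (lcs G 2 : Set G) := by
    rw [← Subgroup.commutator_eq_bot_iff_le_centralizer, eq_bot_iff, ← h.bot]
    exact commutator_lcs_lcs_two_le (by omega)
  obtain ⟨z, hz, hz3⟩ := h.exists_mem_lcs_two
  have hcz : ∀ a ∈ lcs G 2, Commute z a := by
    intro a ha
    rw [h.lcs_two_eq hz hz3] at ha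
    obtain ⟨_, ⟨i, rfl⟩, s, hs, rfl⟩ := Subgroup.mem_sup_of_normal_right.1 ha
    exact ((Commute.refl z).zpow_right i).mul_right
      (Subgroup.mem_centralizer_iff.1 (h3 hs) z hz)
  rw [h.lcs_two_eq hz hz3] at ha
  obtain ⟨_, ⟨i, rfl⟩, s, hs, rfl⟩ := Subgroup.mem_sup_of_normal_right.1 ha
  exact ((hcz b hb).zpow_left i).mul_left (Subgroup.mem_centralizer_iff.1 (h3 hs) b hb).symm

theorem centralizerMod_eq [Finite G] (h : IsClassFour p α) {x : G} (hx : x ∉ lcs G 2) :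
    centralizerMod x = Subgroup.zpowers x ⊔ lcs G 2 := by
  have hi := h.scaling.index_centralizerMod hx
  rw [h.relIndex_two] at hi
  refine eq_of_le_of_index_eq_prime (h.index_zpowers_sup hx) (sup_le ?_ ?_) fun htop => ?_
  · rw [Subgroup.zpowers_le, mem_centralizerMod, commutatorElement_self]
    exact one_mem _
  · exact lcs_two_le_centralizerMod x
  · rw [htop, Subgroup.index_top] at hi
    exact (Fact.out : p.Prime).one_lt.ne hi

/-- Here x centralises G_2 modulo G_4. The three subgroups lemma for G_2, G and x applies because
G_2 is abelian and G_4 is central. -/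
theorem commutes_lcs_three (h : IsClassFour p α) {z x : G} (hz : z ∈ lcs G 2) (hz3 : z ∉ lcs G 3)
    (hzx : ⁅z, x⁆ ∈ lcs G 4) {s : G} (hs : s ∈ lcs G 3) : Commute s x := by
  set X := (Subgroup.centralizer (lcs (G ⧸ lcs G 4) 2 : Set (G ⧸ lcs G 4))).comap
    (QuotientGroup.mk' (lcs G 4)) with hX
  have hx : x ∈ X := by
    rw [hX, Subgroup.mem_comap, Subgroup.mem_centralizer_iff]
    intro t ht
    rw [lcs_quotient] at ht
    obtain ⟨t, ht, rfl⟩ := ht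
    rw [← commutatorElement_eq_one_iff_mul_comm]
    refine (QuotientGroup.eq_one_iff (N := lcs G 4) ⁅t, x⁆).2 ?_
    have ht' := ht
    rw [SetLike.mem_coe, h.lcs_two_eq hz hz3] at ht'
    obtain ⟨_, ⟨i, rfl⟩, r, hr, rfl⟩ := Subgroup.mem_sup_of_normal_right.1 ht'
    have hzx' : Commute (z : G ⧸ lcs G 4) (x : G ⧸ lcs G 4) :=
      commutatorElement_eq_one_iff_commute.1 ((QuotientGroup.eq_one_iff _).2 hzx)
    have hrx' : Commute (r : G ⧸ lcs G 4) (x : G ⧸ lcs G 4) :=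
      commutatorElement_eq_one_iff_commute.1 ((QuotientGroup.eq_one_iff _).2
        (commutator_mem_lcs (by omega : 1 ≤ 3) hr x))
    exact (QuotientGroup.eq_one_iff _).1 (commutatorElement_eq_one_iff_commute.2
      ((hzx'.zpow_left i).mul_left hrx'))
  have hX2 : ⁅X, lcs G 2⁆ ≤ lcs G 4 := by
    rw [Subgroup.commutator_le]
    intro g hg t ht
    rw [hX, Subgroup.mem_comap, Subgroup.mem_centralizer_iff] at hg
    have := hg t (mk_mem_lcs_of_mem _ ht)
    exact (QuotientGroup.eq_one_iff _).1 (commutatorElement_eq_one_iff_mul_comm.2 this.symm)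
  have h1 : ⁅⁅(⊤ : Subgroup G), X⁆, lcs G 2⁆ = ⊥ := by
    rw [eq_bot_iff, Subgroup.commutator_le]
    intro a ha b hb
    rw [Subgroup.mem_bot, commutatorElement_eq_one_iff_commute]
    exact h.commute (Subgroup.commutator_mono le_rfl le_top ha) hb
  have h2 : ⁅⁅X, lcs G 2⁆, (⊤ : Subgroup G)⁆ = ⊥ := by
    rw [eq_bot_iff, ← h.bot, lcs_succ (by omega)]
    exact Subgroup.commutator_mono hX2 le_rfl
  have h3 := Subgroup.commutator_commutator_eq_bot_of_rotate h1 h2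
  rw [← lcs_succ (by omega)] at h3
  rw [← commutatorElement_eq_one_iff_commute, ← Subgroup.mem_bot, ← h3]
  exact Subgroup.commutator_mem_commutator hs hx

/-- Otherwise [z,x] ∈ G_4 is fixed by `α` but also inverted by bilinearity, hence trivial. Then x
commutes with ⟨x⟩G_2, its centraliser modulo G_3, and `eq_one_of_centralizes` kills G_4, where the
eigenvalue is 1 ≢ -1. -/
theorem mem_lcs_two_of_commutator_mem [Finite G] (h : IsClassFour p α) {z x : G}
    (hz : z ∈ lcs G 2) (hz3 : z ∉ lcs G 3) (hzx : ⁅z, x⁆ ∈ lcs G 4) : x ∈ lcs G 2 := by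
  by_contra hx
  have h32 : lcs G 3 ≤ lcs G 2 := lcs_antitone (by omega)
  have h3x := fun {s : G} => h.commutes_lcs_three hz hz3 hzx (s := s)
  have hcom : Commute z x := by
    rw [← commutatorElement_eq_one_iff_commute]
    obtain ⟨s, hs, hs'⟩ : ∃ s ∈ lcs G 3, α z = z * s :=
      ⟨_, h.scaling.map_mem_lcs (by omega : 1 ≤ 2) hz, by simp⟩
    obtain ⟨r, hr, hr'⟩ : ∃ r ∈ lcs G 2, α x = x ^ (-1 : ℤ) * r :=
      ⟨_, h.scaling.map_top x, by simp⟩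
    have hs1 : ⁅s, x ^ (-1 : ℤ) * r⁆ = 1 := commutatorElement_eq_one_iff_commute.2
      (((h3x hs).zpow_right _).mul_right (h.commute (h32 hs) hr))
    have hr1 : ⁅z, r⁆ = 1 := commutatorElement_eq_one_iff_commute.2 (h.commute hz hr)
    have hmap := h.map_four hzx
    rw [map_commutatorElement, hs', hr', commutator_mul_left (by rw [hs1]; exact one_mem _), hs1,
      mul_one, commutator_mul_right (by rw [hr1]; exact one_mem _), hr1, mul_one,
      commutator_zpow_right (h.mem_center hzx)] at hmap
    exact h.eq_one_of_zpow_eq (by simp) hmap.symm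
  refine h.ne_bot (eq_bot_iff.2 fun v hv => Subgroup.mem_bot.2 ?_)
  refine h.scaling.eq_one_of_centralizes hx (fun g hg => ?_) (h.mem_center hv)
    (lcs_antitone (by omega : 3 ≤ 4) hv) (m := 1) (by rw [h.map_four hv, zpow_one]) ?_
  · rw [← mem_centralizerMod, h.centralizerMod_eq hx] at hg
    obtain ⟨_, ⟨i, rfl⟩, r, hr, rfl⟩ := Subgroup.mem_sup_of_normal_right.1 hg
    rw [h.lcs_two_eq hz hz3] at hr
    obtain ⟨_, ⟨j, rfl⟩, s, hs, rfl⟩ := Subgroup.mem_sup_of_normal_right.1 hr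
    rw [commutatorElement_eq_one_iff_commute]
    exact ((Commute.refl x).zpow_right i).mul_right
      ((hcom.symm.zpow_right j).mul_right (h3x hs).symm)
  · exact h.scaling.not_dvd_two

/-- The map g ↦ [z,g] modulo G_4 has kernel G_2 and image G_3/G_4. -/
theorem relIndex_three [Finite G] (h : IsClassFour p α) :
    (lcs G 4).relIndex (lcs G 3) = p ^ 2 := by
  obtain ⟨z, hz, hz3⟩ := h.exists_mem_lcs_two
  have h42 : lcs G 4 ≤ lcs G 2 := lcs_antitone (by omega)
  have hbot : lcs (G ⧸ lcs G 4) 4 = ⊥ := lcs_quotient_eq_bot le_rfl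
  have hZ : ∀ t ∈ lcs (G ⧸ lcs G 4) 3, t ∈ Subgroup.center (G ⧸ lcs G 4) := fun t ht =>
    mem_center_of_mem_lcs (by omega) hbot ht
  have hzq := mk_mem_lcs_of_mem (lcs G 4) hz
  have hc : ∀ g, ⁅(z : G ⧸ lcs G 4), g⁆ ∈ Subgroup.center (G ⧸ lcs G 4) := fun g =>
    hZ _ (commutator_mem_lcs (by omega) hzq g)
  have hker : (commHom (z : G ⧸ lcs G 4) hc).ker = lcs (G ⧸ lcs G 4) 2 := by
    ext g
    rw [MonoidHom.mem_ker, commHom_apply]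
    induction g using QuotientGroup.induction_on with
    | H g =>
      rw [mk_mem_lcs_iff h42]
      refine (QuotientGroup.eq_one_iff (N := lcs G 4) ⁅z, g⁆).trans
        ⟨h.mem_lcs_two_of_commutator_mem hz hz3, fun hg => ?_⟩
      rw [commutatorElement_eq_one_iff_commute.2 (h.commute hz hg)]
      exact one_mem _
  have hrange : (commHom (z : G ⧸ lcs G 4) hc).range = lcs (G ⧸ lcs G 4) 3 := by
    refine le_antisymm ?_ (lcs_succ_le (by omega) fun t ht g => ?_)
    · rintro _ ⟨g, rfl⟩
      exact commutator_mem_lcs (by omega) hzq g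
    · rw [lcs_quotient] at ht
      obtain ⟨t, ht, rfl⟩ := ht
      rw [SetLike.mem_coe, h.lcs_two_eq hz hz3] at ht
      obtain ⟨_, ⟨i, rfl⟩, s, hs, rfl⟩ := Subgroup.mem_sup_of_normal_right.1 ht
      have hs1 : ⁅(s : G ⧸ lcs G 4), g⁆ = 1 := commutatorElement_eq_one_iff_commute.2
        (Subgroup.mem_center_iff.1 (hZ _ (mk_mem_lcs_of_mem _ hs)) g).symm
      change ⁅(z : G ⧸ lcs G 4) ^ i * (s : G ⧸ lcs G 4), g⁆ ∈ _
      rw [commutator_mul_left (by rw [hs1]; exact one_mem _), hs1, mul_one,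
        commutator_zpow_left (hc g)]
      exact Subgroup.zpow_mem _ (MonoidHom.mem_range.2 ⟨g, rfl⟩) i
  have h1 := Subgroup.index_ker (commHom (z : G ⧸ lcs G 4) hc)
  rw [hker, hrange, lcs_quotient _ 3, ← Subgroup.relIndex_ker, QuotientGroup.ker_mk'] at h1
  rw [← h1, ← h.index_two, ← Subgroup.index_comap_of_surjective _
    (QuotientGroup.mk'_surjective (lcs G 4)), comap_lcs_quotient h42]

theorem exists_not_mem (h : IsClassFour p α) :
    ∃ x ∉ lcs G 2, ∃ y, y ∉ Subgroup.zpowers x ⊔ lcs G 2 := by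
  have hp := (Fact.out : p.Prime)
  obtain ⟨x, hx⟩ : ∃ x, x ∉ lcs G 2 := by
    by_contra hcon
    push Not at hcon
    have := h.index_two
    rw [(Subgroup.eq_top_iff' _).2 hcon, Subgroup.index_top] at this
    exact (Nat.one_lt_pow two_ne_zero hp.one_lt).ne this
  refine ⟨x, hx, ?_⟩
  by_contra hcon
  push Not at hcon
  have := h.index_zpowers_sup hx
  rw [(Subgroup.eq_top_iff' _).2 hcon, Subgroup.index_top] at this
  exact hp.one_lt.ne this

/-- For independent x, y modulo G_2, the elements [z,x] and [z,y] are independent modulo G_4.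
Commutation with both maps G onto G_4 × G_4 and kills G_2, whose index is p². -/
theorem card_four [Finite G] (h : IsClassFour p α) : Nat.card (lcs G 4) = p := by
  have hp := (Fact.out : p.Prime)
  obtain ⟨z, hz, hz3⟩ := h.exists_mem_lcs_two
  obtain ⟨x, hx, y, hy⟩ := h.exists_not_mem
  have hx3 : ⁅z, x⁆ ∈ lcs G 3 := commutator_mem_lcs (by omega) hz x
  have hy3 : ⁅z, y⁆ ∈ lcs G 3 := commutator_mem_lcs (by omega) hz y
  have h32 : lcs G 3 ≤ lcs G 2 := lcs_antitone (by omega)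
  have hZ : ∀ g, ⁅(z : G ⧸ lcs G 4), g⁆ ∈ Subgroup.center (G ⧸ lcs G 4) := fun g =>
    mem_center_of_mem_lcs (by omega : 1 ≤ 3) (lcs_quotient_eq_bot le_rfl)
      (commutator_mem_lcs (by omega) (mk_mem_lcs_of_mem _ hz) g)
  have hind : ∀ r s : ℤ, ⁅z, x⁆ ^ r * ⁅z, y⁆ ^ s ∈ lcs G 4 → (p : ℤ) ∣ r ∧ (p : ℤ) ∣ s := by
    intro r s hrs
    refine dvd_of_zpow_mul_zpow_mem h.scaling.isPGroup h.scaling.pow_mem hx hy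
      (h.mem_lcs_two_of_commutator_mem hz hz3 ?_)
    rw [← QuotientGroup.eq_one_iff] at hrs ⊢
    change ⁅(z : G ⧸ lcs G 4), (x : G ⧸ lcs G 4) ^ r * (y : G ⧸ lcs G 4) ^ s⁆ = 1
    rw [commutator_mul_right (hZ _), commutator_zpow_right (hZ _), commutator_zpow_right (hZ _)]
    exact hrs
  have hc : ∀ a ∈ lcs G 3, ∀ g, ⁅a, g⁆ ∈ Subgroup.center G := fun a ha g =>
    h.mem_center (commutator_mem_lcs (by omega) ha g)
  let f : G →* G × G := (commHom ⁅z, x⁆ (hc _ hx3)).prod (commHom ⁅z, y⁆ (hc _ hy3))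
  have hker : lcs G 2 ≤ f.ker := by
    intro t ht
    rw [MonoidHom.mem_ker]
    refine Prod.ext ?_ ?_
    · exact commutatorElement_eq_one_iff_commute.2 (h.commute (h32 hx3) ht)
    · exact commutatorElement_eq_one_iff_commute.2 (h.commute (h32 hy3) ht)
  have hrange : (lcs G 4).prod (lcs G 4) ≤ f.range := by
    rintro ⟨m, n⟩ hmn
    obtain ⟨hm, hn⟩ := Subgroup.mem_prod.1 hmn
    obtain ⟨g, hg1, hg2⟩ := h.scaling.exists_commutator_pair (by omega : 1 ≤ 3) h.bot hx3 hy3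
      (h.commute (h32 hx3) (h32 hy3)) hind (inv_mem hm) (inv_mem hn)
    refine ⟨g, Prod.ext ?_ ?_⟩
    · change ⁅⁅z, x⁆, g⁆ = m
      rw [← commutatorElement_inv, hg1, inv_inv]
    · change ⁅⁅z, y⁆, g⁆ = n
      rw [← commutatorElement_inv, hg2, inv_inv]
  have h1 : Nat.card (lcs G 4) * Nat.card (lcs G 4) ≤ p ^ 2 := by
    rw [← h.index_two, ← Nat.card_prod,
      ← Nat.card_congr ((lcs G 4).prodEquiv (lcs G 4)).toEquiv]
    refine (Subgroup.card_le_of_le hrange).trans ?_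
    rw [← Subgroup.index_ker]
    exact Subgroup.index_antitone hker
  obtain ⟨k, hk⟩ := IsPGroup.iff_card.1 (h.scaling.isPGroup.to_subgroup (lcs G 4))
  rw [hk, ← pow_add] at h1
  have h2 := (Nat.pow_le_pow_iff_right hp.one_lt).1 h1
  have h3 : k ≠ 0 := fun h0 => h.ne_bot (by
    rw [← Subgroup.card_eq_one, hk, h0, pow_zero])
  rw [hk, show k = 1 by omega, pow_one]

theorem centralizer_eq [Finite G] (h : IsClassFour p α) {u x : G} (hu : u ∈ lcs G 3)
    (hu4 : u ∉ lcs G 4) (hx : x ∉ lcs G 2) (hux : Commute u x) :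
    Subgroup.centralizer {u} = Subgroup.zpowers x ⊔ lcs G 2 := by
  refine eq_of_le_of_index_eq_prime (h.index_zpowers_sup hx) (sup_le ?_ fun t ht => ?_)
    fun htop => hu4 ?_
  · rw [Subgroup.zpowers_le, Subgroup.mem_centralizer_singleton_iff]
    exact hux.symm
  · rw [Subgroup.mem_centralizer_singleton_iff]
    exact h.commute ht (lcs_antitone (by omega : 2 ≤ 3) hu)
  · refine h.scaling.mem_lcs_succ_of_mem_center (by omega) h.bot h.ne_bot hu
      (Subgroup.mem_center_iff.2 fun g => ?_)
    have hg : g ∈ Subgroup.centralizer {u} := htop ▸ Subgroup.mem_top g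
    exact Subgroup.mem_centralizer_singleton_iff.1 hg

/-- The map u ↦ [u,x] goes from G_3, where G_4 has index p², to G_4 of order p, so its kernel is not
contained in G_4. -/
theorem exists_commute [Finite G] (h : IsClassFour p α) (x : G) :
    ∃ u ∈ lcs G 3, u ∉ lcs G 4 ∧ Commute u x := by
  have hp := (Fact.out : p.Prime)
  have hmem : ∀ u : lcs G 3, ⁅(u : G), x⁆ ∈ lcs G 4 := fun u =>
    commutator_mem_lcs (by omega) u.2 x
  let f : lcs G 3 →* G :=
    { toFun := fun u => ⁅(u : G), x⁆
      map_one' := commutatorElement_one_left x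
      map_mul' := fun a b => commutator_mul_left (h.mem_center (hmem b)) }
  by_contra hcon
  push Not at hcon
  have hle : f.ker ≤ (lcs G 4).subgroupOf (lcs G 3) := by
    intro u hu
    rw [Subgroup.mem_subgroupOf]
    by_contra hu4
    exact hcon u u.2 hu4 (commutatorElement_eq_one_iff_commute.1 hu)
  have h1 : f.ker.index ≤ p := by
    rw [Subgroup.index_ker, ← h.card_four]
    refine Subgroup.card_le_of_le ?_
    rintro _ ⟨u, rfl⟩
    exact hmem u
  have h2 : p ^ 2 ≤ f.ker.index := by
    rw [← h.relIndex_three]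
    exact Subgroup.index_antitone hle
  have h3 : p ^ 1 < p ^ 2 := Nat.pow_lt_pow_right hp.one_lt (by omega)
  rw [pow_one] at h3
  omega

/-- If x^p ∈ G_4, then x^p = 1 and `α` inverts x. It also inverts some u ∈ G_3 ∖ G_4 commuting with
x, but fixes n ∈ G_4. A stable conjugate of ⟨x, un⟩ would contain both un and its image u⁻¹n, which
is impossible for n ≠ 1. -/
theorem pow_notMem_aux [Finite G] (h : IsClassFour p α) {x : G} (hx : x ∉ lcs G 2) {k : ℤ}
    (hk : α x = x ^ k) : x ^ p ∉ lcs G 4 := by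
  intro hxp
  have hs := h.scaling
  have h42 : lcs G 4 ≤ lcs G 2 := lcs_antitone (by omega)
  have h43 : lcs G 4 ≤ lcs G 3 := lcs_antitone (by omega)
  have h32 : lcs G 3 ≤ lcs G 2 := lcs_antitone (by omega)
  have hk1 : (p : ℤ) ∣ k + 1 := by
    have := hs.map_top x
    rw [hk] at this
    simpa using dvd_sub_of_zpow_mem hs.isPGroup hx this
  have hx1 : x ^ p = 1 := by
    refine h.eq_one_of_zpow_eq hk1 ?_
    have := h.map_four hxp
    rw [map_pow, hk, ← zpow_natCast, ← zpow_mul, mul_comm, zpow_mul, zpow_natCast] at this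
    exact this.symm
  have hαx : α x = x ^ (-1 : ℤ) := hk.trans (zpow_eq_zpow_of_dvd hx1 (by simpa using hk1))
  have hp3 : ∀ w ∈ lcs G 3, w ^ p = 1 := fun w hw => by
    have := hs.pow_mem_lcs (by omega : 1 ≤ 3) hw
    rwa [h.bot, Subgroup.mem_bot] at this
  obtain ⟨u, hu, hu4, hux, hαu⟩ : ∃ u ∈ lcs G 3, u ∉ lcs G 4 ∧ Commute u x ∧ α u = u⁻¹ := by
    obtain ⟨u, hu, hu4, hux⟩ := h.exists_commute x
    obtain ⟨g, l, hl⟩ := hs.conjStable.exists_zpow u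
    have hu' : g * u * g⁻¹ ∈ lcs G 3 := (conj_mem_lcs_iff g).2 hu
    have hu4' : g * u * g⁻¹ ∉ lcs G 4 := by rwa [conj_mem_lcs_iff]
    -- Conjugation changes u only by an element of the central G_4, so the eigenvector still
    -- commutes with x.
    refine ⟨g * u * g⁻¹, hu', hu4', ?_, ?_⟩
    · rw [conj_eq_mul_commutator]
      exact hux.mul_left (Subgroup.mem_center_iff.1 (h.mem_center
        (commutator_mem_lcs (by omega) (inv_mem hu) g)) x).symm
    · have h1 := hs.map_mem_lcs (by omega : 1 ≤ 3) hu'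
      rw [hl] at h1
      rw [hl]
      refine (zpow_eq_zpow_of_dvd (n := -1) (hp3 _ hu') ?_).trans (zpow_neg_one _)
      simpa [pow_succ] using dvd_sub_of_zpow_mem hs.isPGroup hu4' h1
  obtain ⟨n, hn, hn1⟩ := (lcs G 4).bot_or_exists_ne_one.resolve_left h.ne_bot
  have hnc := Subgroup.mem_center_iff.1 (h.mem_center hn)
  have hun : u * n ∈ lcs G 3 := mul_mem hu (h43 hn)
  have hun4 : u * n ∉ lcs G 4 := by rwa [Subgroup.mul_mem_cancel_right _ hn]
  have hxun : Commute x (u * n) := hux.symm.mul_right (hnc x)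
  obtain ⟨g, hg⟩ := hs.conjStable (pairSubgroup hxun)
  obtain ⟨_, ⟨i, j, rfl⟩, hij⟩ := hg x (left_mem_pairSubgroup hxun)
  have hgx : ⁅x⁻¹, g⁆ ∈ lcs G 3 := by
    refine hs.mem_lcs_three_of_map_mem (x := x) (commutator_mem_lcs_two _ _) ?_ ?_
    · rw [hαx, inv_mul_cancel]
      exact one_mem _
    · rw [← conj_eq_mul_commutator]
      refine hs.map_mem_lcs_three (k := i) (by rwa [conj_mem_lcs_iff]) ?_
      have e : ((g * x * g⁻¹) ^ i)⁻¹ * (g * (x ^ i * (u * n) ^ j) * g⁻¹) =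
          g * (u * n) ^ j * g⁻¹ := by
        rw [conj_zpow]
        group
      rw [hij, e, conj_mem_lcs_iff]
      exact zpow_mem hun j
  -- As g commutes with x modulo G_3, it lies in ⟨x⟩G_2, all of which commutes with un.
  have hgu : Commute (u * n) g := by
    rw [commutator_inv_mem_lcs_iff, ← mem_centralizerMod, h.centralizerMod_eq hx] at hgx
    obtain ⟨_, ⟨l, rfl⟩, r, hr, rfl⟩ := Subgroup.mem_sup_of_normal_right.1 hgx
    exact (hxun.symm.zpow_right l).mul_right (h.commute (h32 hun) hr)
  obtain ⟨_, ⟨i', j', rfl⟩, hij'⟩ := hg (u * n) (right_mem_pairSubgroup hxun)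
  rw [← hgu.eq, mul_inv_cancel_right, map_mul, hαu, h.map_four hn] at hij'
  -- Since u⁻¹n ∈ G_2, no x-part survives; so u⁻¹n is a power of un, with exponent ≡ -1 modulo p.
  have hi' : x ^ i' = 1 := by
    refine zpow_eq_one_of_dvd hx1 ?_
    by_contra hnd
    refine hx (mem_of_zpow_mem hs.isPGroup (i := i') ?_ hnd)
    rw [← Subgroup.mul_mem_cancel_right _ (zpow_mem (h32 hun) j'), ← conj_mem_lcs_iff g, ← hij']
    exact mul_mem (inv_mem (h32 hu)) (h42 hn)
  rw [hi', one_mul, ← (hgu.zpow_left j').eq, mul_inv_cancel_right] at hij'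
  have hj' : (p : ℤ) ∣ j' + 1 := by
    have : ((u * n) ^ (-1 : ℤ))⁻¹ * (u * n) ^ j' ∈ lcs G 4 := by
      have e : ((u * n) ^ (-1 : ℤ))⁻¹ * (u⁻¹ * n) = n * n := by
        rw [zpow_neg_one, inv_inv, hnc u, mul_assoc, mul_inv_cancel_left]
      rw [← hij', e]
      exact mul_mem hn hn
    simpa using dvd_sub_of_zpow_mem hs.isPGroup hun4 this
  refine hn1 (h.eq_one_of_zpow_eq hj' ?_)
  rw [zpow_eq_zpow_of_dvd (n := -1) (hp3 _ hun) (by simpa using hj'), zpow_neg_one, mul_inv_rev,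
    hnc u⁻¹] at hij'
  rw [zpow_eq_zpow_of_dvd (n := -1) (hp3 _ (h43 hn)) (by simpa using hj'), zpow_neg_one]
  have hnc' := Subgroup.mem_center_iff.1 (inv_mem (h.mem_center hn))
  exact mul_right_cancel hij'

theorem pow_notMem [Finite G] (h : IsClassFour p α) {x : G} (hx : x ∉ lcs G 2) :
    x ^ p ∉ lcs G 4 := by
  obtain ⟨g, k, hk⟩ := h.scaling.conjStable.exists_zpow x
  rw [← conj_mem_lcs_iff g, ← conj_pow]
  exact h.pow_notMem_aux (by rwa [conj_mem_lcs_iff]) hk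

end IsClassFour

variable [Fact p.Prime]

/-- Since G/G_2 has exponent p, ℓ may be replaced by -1 itself, so that `α` fixes the even layers
and inverts the odd ones. -/
theorem of_dvd_add_one (h : IsScaling p ℓ α) (hd : (p : ℤ) ∣ ℓ + 1) : IsScaling p (-1) α where
  isPGroup := h.isPGroup
  conjStable := h.conjStable
  map_top x := by
    obtain ⟨c, hc⟩ := hd
    have h1 : (x ^ (-1 : ℤ))⁻¹ * x ^ ℓ ∈ lcs G 2 := by
      rw [← zpow_neg, ← zpow_add, neg_neg, add_comm, hc, zpow_mul, zpow_natCast]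
      exact zpow_mem (h.pow_mem x) c
    have := mul_mem h1 (h.map_top x)
    rwa [mul_assoc, mul_inv_cancel_left] at this
  pow_mem := h.pow_mem
  not_dvd := fun h1 => by
    have := (Int.natCast_dvd_natCast (n := 1)).1 (by simpa using h1)
    exact (Fact.out : p.Prime).one_lt.ne' (Nat.dvd_one.1 this)
  not_dvd_sub_one := fun h1 => h.not_dvd_sub_one (by
    have := dvd_add hd h1
    rwa [show ℓ + 1 + (-1 - 1) = ℓ - 1 by ring] at this)

/-- Modulo `G_4`, the `p`-th power of `x` depends only on `x` modulo `G_2`. -/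
theorem pow_mul_pow_mem (h : IsScaling p (-1) α) (x : G) {t : G} (ht : t ∈ lcs G 2) :
    (x ^ p)⁻¹ * (x * t) ^ p ∈ lcs G 4 := by
  have hp := (Fact.out : p.Prime)
  have h3 : ⁅t, x⁆ ∈ lcs G 3 := commutator_mem_lcs (by omega) ht x
  have hc : ⁅(t : G ⧸ lcs G 4), (x : G ⧸ lcs G 4)⁆ ∈ Subgroup.center (G ⧸ lcs G 4) :=
    mem_center_of_mem_lcs (by omega : 1 ≤ 3) (lcs_quotient_eq_bot le_rfl)
      (mk_mem_lcs_of_mem (lcs G 4) h3)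
  have ht1 : (t : G ⧸ lcs G 4) ^ p = 1 :=
    (QuotientGroup.eq_one_iff _).2 (h.pow_mem_lcs (by omega : 1 ≤ 2) ht)
  have hc1 : ⁅(t : G ⧸ lcs G 4), (x : G ⧸ lcs G 4)⁆ ^ p = 1 :=
    (QuotientGroup.eq_one_iff (⁅t, x⁆ ^ p)).2 (h.pow_mem_lcs_succ (by omega : 1 ≤ 3) h3)
  -- As p is odd, p divides the exponent `p.choose 2` of the commutator in the expansion of (xt)^p.
  have h2 : 2 < p := lt_of_le_of_ne hp.two_le fun h2 => h.not_dvd_two (by rw [← h2]; rfl)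
  obtain ⟨c, hc2⟩ := hp.dvd_choose_self two_ne_zero h2
  rw [← QuotientGroup.eq, QuotientGroup.mk_pow, QuotientGroup.mk_pow, QuotientGroup.mk_mul,
    mul_pow_of_commutator_mem_center hc, ht1, hc2, pow_mul, hc1, one_pow, mul_one, mul_one]

/-- As y commutes with y^p and x^p differs from it by a central element, y lies in the centraliser
⟨x⟩G_2 of x^p. Writing y = x^i t, comparison of p-th powers gives i ≡ 1. -/
theorem IsClassFour.mem_of_pow_mem [Finite G] (h : IsClassFour p α) {x y : G}
    (hxy : (x ^ p)⁻¹ * y ^ p ∈ lcs G 4) : x⁻¹ * y ∈ lcs G 2 := by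
  by_cases hx : x ∈ lcs G 2
  · refine mul_mem (inv_mem hx) ?_
    by_contra hy
    refine h.pow_notMem hy ((Subgroup.mul_mem_cancel_left _ (inv_mem ?_)).1 hxy)
    exact h.scaling.pow_mem_lcs (by omega : 1 ≤ 2) hx
  have hu : x ^ p ∈ lcs G 3 :=
    h.scaling.pow_mem_lcs le_rfl (by rw [lcs_one]; exact Subgroup.mem_top x)
  have hu4 := h.pow_notMem hx
  have hC := h.centralizer_eq hu hu4 hx ((Commute.refl x).pow_left p)
  have hy : y ∈ Subgroup.centralizer {x ^ p} := by
    rw [Subgroup.mem_centralizer_singleton_iff]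
    have h1 : x ^ p = y ^ p * ((x ^ p)⁻¹ * y ^ p)⁻¹ := by group
    rw [h1]
    exact ((Commute.refl y).pow_right p).mul_right
      (Subgroup.mem_center_iff.1 (inv_mem (h.mem_center hxy)) y)
  rw [hC] at hy
  obtain ⟨_, ⟨i, rfl⟩, t, ht, rfl⟩ := Subgroup.mem_sup_of_normal_right.1 hy
  have h1 := h.scaling.pow_mul_pow_mem (x ^ i) ht
  have h2 : ((x ^ p) ^ (1 : ℤ))⁻¹ * (x ^ p) ^ i ∈ lcs G 4 := by
    have := mul_mem hxy (inv_mem h1)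
    rw [mul_inv_rev, inv_inv, mul_assoc, mul_inv_cancel_left] at this
    rwa [zpow_one, ← zpow_natCast x p, ← zpow_mul, mul_comm, zpow_mul, zpow_natCast,
      zpow_natCast]
  obtain ⟨c, hc⟩ := dvd_sub_of_zpow_mem h.scaling.isPGroup hu4 h2
  change x⁻¹ * (x ^ i * t) ∈ _
  rw [← mul_assoc, ← zpow_neg_one, ← zpow_add, neg_add_eq_sub, hc, zpow_mul, zpow_natCast]
  exact mul_mem (zpow_mem (h.scaling.pow_mem x) c) ht

end IsScaling

/-! ### The Frattini quotient is G/G_2. -/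

section Frattini

theorem lcs_two_le_frattiniP {p : ℕ} {G : Type*} [Group G] : lcs G 2 ≤ frattiniP p G := le_sup_left

theorem frattiniP_quotient_mk_mem {p : ℕ} {G : Type*} [Group G] (N : Subgroup G)
    [N.Normal] {x : G} (hx : x ∈ frattiniP p G) :
    (x : G ⧸ N) ∈ frattiniP p (G ⧸ N) := by
  have hle : frattiniP p G ≤ (frattiniP p (G ⧸ N)).comap (QuotientGroup.mk' N) := by
    refine sup_le ?_ ?_
    · intro y hy
      exact lcs_two_le_frattiniP (mk_mem_lcs_of_mem N (i := 2) hy)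
    · rw [Subgroup.closure_le]
      rintro _ ⟨y, rfl⟩
      exact Subgroup.mem_sup_right (Subgroup.subset_closure ⟨(y : G ⧸ N), rfl⟩)
  exact hle hx

variable {p : ℕ} [Fact p.Prime] {G : Type*} [Group G] {α : G →* G} {ℓ : ℤ}

/-- If `G_2` is central, nontrivial and elementary abelian, then `G` has exponent `p`. -/
theorem pow_eq_one_of_lcs_two (hG : IsPGroup p G) (hα : ConjStable α)
    (hmap : ∀ x, (x ^ ℓ)⁻¹ * α x ∈ frattiniP p G) (h0 : ¬ (p : ℤ) ∣ ℓ)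
    (h1 : ¬ (p : ℤ) ∣ ℓ - 1) (hbot : lcs G 3 = ⊥) (hne : lcs G 2 ≠ ⊥)
    (hexp : ∀ t ∈ lcs G 2, t ^ p = 1) (x : G) : x ^ p = 1 := by
  have hp := Nat.prime_iff_prime_int.1 (Fact.out : p.Prime)
  have hZ : ∀ t ∈ lcs G 2, t ∈ Subgroup.center G := fun t ht =>
    mem_center_of_mem_lcs (by omega) hbot ht
  have hcc : ∀ x y : G, ⁅x, y⁆ ∈ Subgroup.center G := fun x y => hZ _ (commutator_mem_lcs_two x y)
  have hpow : ∀ x : G, x ^ p ∈ Subgroup.center G := fun x => Subgroup.mem_center_iff.2 fun g => by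
    rw [eq_comm, ← commutatorElement_eq_one_iff_mul_comm, ← zpow_natCast,
      commutator_zpow_left (hcc x g), zpow_natCast]
    exact hexp _ (commutator_mem_lcs_two x g)
  have hΦ : frattiniP p G ≤ Subgroup.center G := by
    refine sup_le hZ ?_
    rw [Subgroup.closure_le]
    rintro _ ⟨x, rfl⟩
    exact hpow x
  have hm : ∀ n ∈ lcs G 2, α n = n ^ (ℓ * ℓ) := by
    let K : Subgroup G :=
      { carrier := {t | t ∈ Subgroup.center G ∧ α t = t ^ (ℓ * ℓ)}
        one_mem' := ⟨one_mem _, by simp⟩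
        mul_mem' := by
          rintro a b ⟨ha, ha1⟩ ⟨hb, hb1⟩
          exact ⟨mul_mem ha hb, by
            rw [map_mul, ha1, hb1, Commute.mul_zpow (Subgroup.mem_center_iff.1 hb a)]⟩
        inv_mem' := by
          rintro a ⟨ha, ha1⟩
          exact ⟨inv_mem ha, by rw [map_inv, ha1, inv_zpow]⟩ }
    have hle : lcs G 2 ≤ K := by
      refine lcs_succ_le le_rfl fun t _ g => ⟨hcc t g, ?_⟩
      have e : ∀ y, ∃ r ∈ Subgroup.center G, α y = y ^ ℓ * r := fun y =>
        ⟨_, hΦ (hmap y), by simp⟩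
      obtain ⟨r, hr, hr'⟩ := e t
      obtain ⟨s, hs, hs'⟩ := e g
      have hr1 : ∀ y : G, ⁅r, y⁆ = 1 := fun y => commutatorElement_eq_one_iff_mul_comm.2
        (Subgroup.mem_center_iff.1 hr y).symm
      have hs1 : ∀ y : G, ⁅y, s⁆ = 1 := fun y => commutatorElement_eq_one_iff_mul_comm.2
        (Subgroup.mem_center_iff.1 hs y)
      rw [map_commutatorElement, hr', hs', commutator_mul_left (hcc _ _), hr1, mul_one,
        commutator_mul_right (hcc _ _), hs1, mul_one, commutator_zpow_zpow (hcc _ _)]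
    exact fun n hn => (hle hn).2
  have hkm : ¬ (p : ℤ) ∣ ℓ - ℓ * ℓ := by
    rw [show ℓ - ℓ * ℓ = -(ℓ * (ℓ - 1)) by ring, dvd_neg]
    intro hd
    exact (hp.dvd_or_dvd hd).elim h0 h1
  -- Outside Φ(G) a conjugate y of x has eigenvalue ≡ ℓ, and so has the central element y^p. By
  -- uniqueness of the central eigenvalue y^p ∈ G_2; there the eigenvalue is ℓ² ≢ ℓ, so y^p = 1.
  have key : ∀ x, x ∉ frattiniP p G → x ^ p = 1 := by
    intro x hx
    obtain ⟨g, k, hk⟩ := hα.exists_zpow x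
    have hn := frattiniP_normal p G
    have hy : g * x * g⁻¹ ∉ frattiniP p G := fun hc => hx (by
      simpa [mul_assoc] using hn.conj_mem _ hc g⁻¹)
    have hkl : (p : ℤ) ∣ k - ℓ := by
      have := hmap (g * x * g⁻¹)
      rw [hk] at this
      exact dvd_sub_of_zpow_mem hG hy this
    have hkm' : ¬ (p : ℤ) ∣ k - ℓ * ℓ := fun hd => hkm (by
      have := dvd_sub hd hkl
      rwa [show k - ℓ * ℓ - (k - ℓ) = ℓ - ℓ * ℓ by ring] at this)
    have hs : α ((g * x * g⁻¹) ^ p) = ((g * x * g⁻¹) ^ p) ^ k := by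
      rw [map_pow, hk, ← zpow_natCast, ← zpow_natCast, ← zpow_mul, ← zpow_mul, mul_comm]
    have hmem := hα.mem_of_mem_center hG hZ hne hm (hpow _) (k := k)
      (by rw [hs, inv_mul_cancel]; exact one_mem _) hkm'
    have h2 := hm _ hmem
    rw [hs] at h2
    have h3 : (g * x * g⁻¹) ^ p = 1 := by
      by_contra hne1
      exact hkm' (dvd_sub_of_zpow_eq hG hne1 h2.symm)
    rw [conj_pow] at h3
    simpa using h3
  -- An element of the central subgroup Φ(G) is handled by multiplying it with an element outside.
  by_cases hx : x ∈ frattiniP p G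
  · obtain ⟨y, hy⟩ : ∃ y, y ∉ frattiniP p G := by
      by_contra hcon
      push Not at hcon
      refine hne (eq_bot_iff.2 (lcs_succ_le le_rfl fun t _ g => ?_))
      rw [Subgroup.mem_bot, commutatorElement_eq_one_iff_mul_comm]
      exact Subgroup.mem_center_iff.1 (hΦ (hcon g)) t
    have hxy : x * y ∉ frattiniP p G := by rwa [Subgroup.mul_mem_cancel_left _ hx]
    have h2 := key _ hxy
    rwa [Commute.mul_pow (Subgroup.mem_center_iff.1 (hΦ hx) y).symm, key y hy, mul_one] at h2
  · exact key x hx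

/-- In a nonabelian finite `p`-group with such an endomorphism, `G / G_2` has exponent `p`. -/
theorem isScaling_of_frattiniP [Finite G] (hG : IsPGroup p G) (hα : ConjStable α)
    (hmap : ∀ x, (x ^ ℓ)⁻¹ * α x ∈ frattiniP p G) (h0 : ¬ (p : ℤ) ∣ ℓ)
    (h1 : ¬ (p : ℤ) ∣ ℓ - 1) (hne : lcs G 2 ≠ ⊥) : IsScaling p ℓ α := by
  have hnil : Group.IsNilpotent G := hG.isNilpotent
  have hpow : ∀ x : G, x ^ p ∈ lcs G 2 := by
    intro x
    obtain ⟨M, hMn, h3M, hM2, hMp, hexp⟩ := exists_relIndex_eq_prime hG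
      (lcs_lt_of_ne_bot (by omega) hne) (lcs_succ (G := G) (by omega : 1 ≤ 2)).ge
    refine hM2 ((QuotientGroup.eq_one_iff _).1 (pow_eq_one_of_lcs_two (ℓ := ℓ)
      (hG.to_quotient M) (hα.quotient M fun _ hx => hα.map_mem M hx) (fun y => ?_) h0 h1
      (lcs_quotient_eq_bot h3M) (fun hbot => ?_) (fun t ht => ?_) (x : G ⧸ M)))
    · induction y using QuotientGroup.induction_on with
      | H y => exact frattiniP_quotient_mk_mem M (hmap y)
    · rw [lcs_quotient, Subgroup.map_eq_bot_iff, QuotientGroup.ker_mk'] at hbot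
      rw [Subgroup.relIndex_eq_one.2 hbot] at hMp
      exact (Fact.out : p.Prime).one_lt.ne hMp
    · rw [lcs_quotient] at ht
      obtain ⟨t, ht, rfl⟩ := ht
      exact (QuotientGroup.eq_one_iff (t ^ p)).2 (hexp t ht)
  have hΦ : frattiniP p G = lcs G 2 := by
    refine le_antisymm (sup_le le_rfl ?_) lcs_two_le_frattiniP
    rw [Subgroup.closure_le]
    rintro _ ⟨x, rfl⟩
    exact hpow x
  exact ⟨hG, hα, fun x => hΦ ▸ hmap x, hpow, h0, h1⟩

end Frattini

/-! ### From intensity to stable conjugates. -/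

section Intensity

variable {p : ℕ} [Fact p.Prime] {G : Type*} [Group G] [Finite G]

/-- An intense automorphism of prime power order coprime to `p` stabilises a conjugate of each
subgroup. -/
theorem IsIntense.conjStable (hG : IsPGroup p G) {α : MulAut G} (hα : IsIntense α) {q k : ℕ}
    [Fact q.Prime] (hqp : q ≠ p) (hord : α ^ q ^ k = 1) : ConjStable α.toMonoidHom := by
  classical
  intro H
  let X := MulAction.orbit (ConjAct G) H
  have hmap : ∀ β : MulAut G, IsIntense β → ∀ K : Subgroup G, K ∈ X →
      K.map β.toMonoidHom ∈ X := by
    rintro β hβ K ⟨g, rfl⟩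
    obtain ⟨c, hc⟩ := hβ (g • H)
    rw [hc]
    exact ⟨ConjAct.toConjAct c * g, mul_smul _ _ _⟩
  have hinv : IsIntense α⁻¹ := (intenseAut G).inv_mem hα
  let σ : Equiv.Perm X :=
    { toFun := fun K => ⟨K.1.map α.toMonoidHom, hmap α hα K.1 K.2⟩
      invFun := fun K => ⟨K.1.map (α⁻¹ : MulAut G).toMonoidHom, hmap _ hinv K.1 K.2⟩
      left_inv := fun K => Subtype.ext (by
        ext x
        simp [Subgroup.mem_map])
      right_inv := fun K => Subtype.ext (by
        ext x
        simp [Subgroup.mem_map]) }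
  have hσ : ∀ (n : ℕ) (K : X), ((σ ^ n) K).1 = K.1.map (α ^ n : MulAut G).toMonoidHom := by
    intro n
    induction n with
    | zero =>
      intro K
      ext x
      simp [Subgroup.mem_map]
    | succ n ih =>
      intro K
      rw [pow_succ, Equiv.Perm.mul_apply, ih, pow_succ]
      change (K.1.map α.toMonoidHom).map _ = _
      rw [Subgroup.map_map]
      rfl
  have hσ1 : σ ^ q ^ k = 1 := by
    ext1 K
    refine Subtype.ext ?_
    rw [hσ, hord]
    ext x
    simp [Subgroup.mem_map]
  have hfin : Finite X := inferInstance
  have : Fintype X := Fintype.ofFinite X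
  -- The conjugacy class has p-power size, prime to q, so a permutation of q-power order has a fixed
  -- point on it.
  obtain ⟨n, hn⟩ := (hG.of_equiv ConjAct.toConjAct).card_orbit H
  have hcard : ¬ q ∣ Fintype.card X := by
    rw [← Nat.card_eq_fintype_card, hn]
    intro hd
    exact hqp ((Nat.prime_dvd_prime_iff_eq Fact.out Fact.out).1
      ((Fact.out : q.Prime).dvd_of_dvd_pow hd))
  obtain ⟨⟨K, g, rfl⟩, hK⟩ := Equiv.Perm.exists_fixed_point_of_prime hcard hσ1
  refine ⟨ConjAct.ofConjAct g, fun x hx => ?_⟩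
  have h1 : (g • H).map α.toMonoidHom = g • H := congrArg Subtype.val hK
  have h2 : α (g • x) ∈ g • H := by
    rw [← h1]
    exact ⟨g • x, Subgroup.smul_mem_pointwise_smul x g H hx, rfl⟩
  obtain ⟨y, hy, hxy⟩ := Subgroup.mem_smul_pointwise_iff_exists _ _ _ |>.1 h2
  refine ⟨y, hy, ?_⟩
  rw [← ConjAct.smul_def, ← ConjAct.smul_def, hxy]
  rfl

/-- A group of intensity greater than `1` has an endomorphism stabilising a conjugate of each
subgroup and acting on the Frattini quotient as a nontrivial scalar. -/
theorem exists_conjStable_of_one_lt_intensity (hG : IsPGroup p G) (hint : 1 < intensity p G) :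
    ∃ (α : G →* G) (ℓ : ℤ), ConjStable α ∧ (∀ x, (x ^ ℓ)⁻¹ * α x ∈ frattiniP p G) ∧
      ¬ (p : ℤ) ∣ ℓ ∧ ¬ (p : ℤ) ∣ ℓ - 1 := by
  set μ : intenseAut G →* (ZMod p)ˣ :=
    (scalar p (frattiniP_quotient_comm p G) (frattiniP_quotient_pow p G)).comp
      (inducedHom (frattiniP p G)) with hμ
  have hμspec : ∀ (a : intenseAut G) (x : G),
      (((a : MulAut G) x : G) : G ⧸ frattiniP p G) =
        (x : G ⧸ frattiniP p G) ^ ((μ a : ZMod p).val) := fun a x =>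
    (existsUnique_scalar p (frattiniP_quotient_comm p G)
      (frattiniP_quotient_pow p G)).choose_spec.1 (inducedHom (frattiniP p G) a)
        (x : G ⧸ frattiniP p G)
  obtain ⟨a, ha⟩ : ∃ a, μ a ≠ 1 := by
    by_contra hcon
    push Not at hcon
    have htop : (intenseChar p G).ker = ⊤ := by
      rw [Subgroup.eq_top_iff']
      intro a
      rw [MonoidHom.mem_ker]
      change teichmullerChar p (μ a) = 1
      rw [hcon a, map_one]
    rw [intensity, htop, Subgroup.index_top] at hint
    exact lt_irrefl 1 hint
  have hr : orderOf (μ a) ≠ 1 := fun h => ha (orderOf_eq_one_iff.1 h)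
  obtain ⟨q, hq, hqr⟩ := Nat.exists_prime_and_dvd hr
  have : Fact q.Prime := ⟨hq⟩
  have hqp : q ≠ p := by
    rintro rfl
    have h1 : q ∣ q - 1 := hqr.trans (by
      rw [← ZMod.card_units q]
      exact orderOf_dvd_card)
    have h2 := Nat.le_of_dvd (Nat.sub_pos_of_lt hq.one_lt) h1
    have := hq.one_lt
    omega
  have hn : orderOf a ≠ 0 := (orderOf_pos a).ne'
  -- The power a^m has q-power order, and since q ∤ m while q divides the order of its scalar, that
  -- scalar stays nontrivial.
  obtain ⟨k, m, hqm, hkm⟩ := Nat.exists_eq_pow_mul_and_not_dvd hn q hq.ne_one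
  have hb : μ (a ^ m) ≠ 1 := by
    rw [map_pow]
    intro h1
    exact hqm (hqr.trans (orderOf_dvd_of_pow_eq_one h1))
  have hbord : ((a ^ m : intenseAut G) : MulAut G) ^ q ^ k = 1 := by
    rw [← SubgroupClass.coe_pow, ← pow_mul, mul_comm, ← hkm, pow_orderOf_eq_one]
    rfl
  set b := a ^ m
  refine ⟨(b : MulAut G).toMonoidHom, ((μ b : ZMod p).val : ℤ),
    IsIntense.conjStable hG b.2 hqp hbord, fun x => ?_, fun hd => ?_, fun hd => hb ?_⟩
  · rw [← QuotientGroup.eq, QuotientGroup.mk_zpow, zpow_natCast]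
    exact (hμspec b x).symm
  · rw [← ZMod.intCast_zmod_eq_zero_iff_dvd, Int.cast_natCast, ZMod.natCast_zmod_val] at hd
    exact (μ b).ne_zero hd
  · rw [← ZMod.intCast_zmod_eq_zero_iff_dvd, Int.cast_sub, Int.cast_natCast,
      ZMod.natCast_zmod_val, Int.cast_one, sub_eq_zero] at hd
    exact Units.ext hd

end Intensity

end Intense

/-! ### The main theorem. -/

theorem theoremA5 (p : ℕ) [Fact p.Prime] (G : Type*) [Group G] [Finite G] (hG : IsPGroup p G)
    (hclass : 4 ≤ Group.nilpotencyClass G) (hint : 1 < Intense.intensity p G) :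
    (Intense.width p G 1, Intense.width p G 2, Intense.width p G 3, Intense.width p G 4)
        = (2, 1, 2, 1) ∧
      ∃ ρ : G ⧸ Intense.lcs G 2 → Intense.lcs G 3 ⧸ (Intense.lcs G 4).subgroupOf (Intense.lcs G 3),
        Function.Bijective ρ ∧
          ∀ x : G, ∃ hx : x ^ p ∈ Intense.lcs G 3,
            ρ (QuotientGroup.mk x) = QuotientGroup.mk ⟨x ^ p, hx⟩ := by
  open Intense in
  have hnil : Group.IsNilpotent G := hG.isNilpotent
  have hp := (Fact.out : p.Prime)
  have h4 : lcs G 4 ≠ ⊥ := fun h => by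
    have := Subgroup.lowerCentralSeries_eq_bot_iff_nilpotencyClass_le.1 h
    omega
  have hne : ∀ i ≤ 4, lcs G i ≠ ⊥ := fun i hi h0 =>
    h4 (eq_bot_iff.2 ((lcs_antitone hi).trans h0.le))
  obtain ⟨α, ℓ, hα, hmap, h0, h1⟩ := exists_conjStable_of_one_lt_intensity hG hint
  have hs := isScaling_of_frattiniP hG hα hmap h0 h1 (hne 2 (by omega))
  obtain ⟨hw1, hw2, hℓ⟩ := hs.class_three (hne 3 (by omega))
  have hs := hs.of_dvd_add_one hℓ
  have h54 : lcs G 5 ≤ lcs G 4 := lcs_antitone (by omega)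
  have h53 : lcs G 5 ≤ lcs G 3 := lcs_antitone (by omega)
  have h52 : lcs G 5 ≤ lcs G 2 := lcs_antitone (by omega)
  -- Dividing by G_5 gives class exactly 4 and leaves the first four layers unchanged.
  have hQ : IsScaling.IsClassFour p (QuotientGroup.map (lcs G 5) (lcs G 5) α (hs.le_comap _)) :=
    { scaling := hs.quotient (lcs G 5)
      bot := lcs_quotient_eq_bot le_rfl
      ne_bot := fun hb => by
        rw [lcs_quotient, Subgroup.map_eq_bot_iff, QuotientGroup.ker_mk'] at hb
        exact (lcs_lt_of_ne_bot (by omega) h4).not_ge hb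
      index_two := by
        rw [← hw1, ← comap_lcs_quotient h52,
          Subgroup.index_comap_of_surjective _ (QuotientGroup.mk'_surjective _)]
      relIndex_two := by rw [relIndex_lcs_quotient h53, hw2] }
  have hw3 : (lcs G 4).relIndex (lcs G 3) = p ^ 2 := by
    rw [← relIndex_lcs_quotient h54, hQ.relIndex_three]
  have hw4 : (lcs G 5).relIndex (lcs G 4) = p := by
    rw [← relIndex_lcs_quotient le_rfl, lcs_quotient_eq_bot le_rfl, Subgroup.relIndex_bot_left,
      hQ.card_four]
  have hlog : Real.logb p p = 1 :=
    Real.logb_self_eq_one (by exact_mod_cast hp.one_lt)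
  have hlog2 : Real.logb p ((p ^ 2 : ℕ) : ℝ) = 2 := by
    rw [Nat.cast_pow, Real.logb_pow, hlog]
    norm_num
  have hpow3 : ∀ x : G, x ^ p ∈ lcs G 3 := fun x =>
    hs.pow_mem_lcs le_rfl (by rw [lcs_one]; exact Subgroup.mem_top x)
  refine ⟨?_, ?_⟩
  · have hw1' : (lcs G 2).relIndex (lcs G 1) = p ^ 2 := by
      rw [lcs_one, Subgroup.relIndex_top_right, hw1]
    simp only [width, Nat.reduceAdd, hw1', hw2, hw3, hw4, hlog, hlog2]
  · let ρ : G ⧸ lcs G 2 → lcs G 3 ⧸ (lcs G 4).subgroupOf (lcs G 3) :=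
      Quotient.lift (fun x => QuotientGroup.mk ⟨x ^ p, hpow3 x⟩) fun x y hxy => by
        rw [QuotientGroup.eq, Subgroup.mem_subgroupOf]
        have := hs.pow_mul_pow_mem x (QuotientGroup.leftRel_apply.1 hxy)
        rwa [mul_inv_cancel_left] at this
    have hinj : Function.Injective ρ := by
      intro x y hxy
      induction x using QuotientGroup.induction_on with
      | H x =>
        induction y using QuotientGroup.induction_on with
        | H y =>
          have h2 : (x ^ p)⁻¹ * y ^ p ∈ lcs G 4 := (QuotientGroup.eq
            (s := (lcs G 4).subgroupOf (lcs G 3)) (a := ⟨x ^ p, hpow3 x⟩)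
            (b := ⟨y ^ p, hpow3 y⟩)).1 hxy
          rw [QuotientGroup.eq]
          refine (mk_mem_lcs_iff h52).1 (hQ.mem_of_pow_mem (x := (x : G ⧸ lcs G 5))
            (y := (y : G ⧸ lcs G 5)) ?_)
          exact mk_mem_lcs_of_mem (lcs G 5) h2
    refine ⟨ρ, (Nat.bijective_iff_injective_and_card ρ).2 ⟨hinj, ?_⟩, fun x => ⟨hpow3 x, rfl⟩⟩
    rw [← Subgroup.index_eq_card, ← Subgroup.index_eq_card, hw1]
    exact hw3.symm
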